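/- Throughout, $M$ is a compact smooth manifold (possibly with boundary or corners), $n\ge 1$, and $\mathbf I=[-1,1]$. A smooth embedding is a smooth topological embedding with injective differentials (boundary need not be sent to boundary). Spaces of embeddings carry the weak $C^\infty$-topology. **Spaces.** $EC(k,M)$ is the space of smooth embeddings $f$ of $\mathbb R^k\times M$ into itself with $\{x: f(x)\ne x\}\subset \mathbf I^k\times M$. $PEC(n,M)$ is the space of smooth embeddings $f$ of $\mathbb R^n\times M$ into itself with $\{x: f(x)\ne x\}\subset[-1,\infty)\times\mathbf I^{n-1}\times M$ for which there is $g\in EC(n-1,M)$ with $f(t_1,\dots,t_n,m)=(t_1,g(t_2,\dots,t_n,m))$ whenever $t_1\ge 1$. $\Omega EC(n-1,M)$ is the space of smooth $F:\mathbb R\to EC(n-1,M)$ (that is, $(t,x)\mapsto F(t)(x)$ is smooth on $\mathbb R\times\mathbb R^{n-1}\times M$) with $F(t)=\mathrm{Id}$ for $t\notin\mathbf I$, with the weak $C^\infty$-topology of the maps $(t,x)\mapsto F(t)(x)$. **Maps.** The fibre inclusion $EC(n,M)\to PEC(n,M)$ is the inclusion; the projection $PEC(n,M)\to EC(n-1,M)$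 is restriction to $\{1\}\times\mathbb R^{n-1}\times M$, identified with $\mathbb R^{n-1}\times M$; the graphing map $\mathrm{gr}_1:\Omega EC(n-1,M)\to EC(n,M)$ is $\mathrm{gr}_1(F)(t_0,t,v)=(t_0,F(t_0)(t,v))$. **Actions.** A little $k$-cube is $L=l_1\times\cdots\times l_k$, where $l_i(t)=a_it+b_i$, $a_i>0$, $l_i(\mathbf I)\subset\mathbf I$; $\mathcal C_k(j)$ is the space of $j$-tuples of little $k$-cubes with pairwise disjoint interiors, and $\mathcal C_k$ is the operad of little $k$-cubes. For a self-embedding $f$ of $\mathbb R^k\times M$ put $L.f=(L\times\mathrm{Id}_M)\circ f\circ(L^{-1}\times\mathrm{Id}_M)$. * $\mathcal C_n$ acts on $EC(n,M)$ by $(L,f)\mapsto L_1.f_1\circ\cdots\circ L_j.f_j$. * $\mathcal C_n$ acts on $PEC(n,M)$ by $(L,f)\mapsto L_{\sigma(1)}.f_{\sigma(1)}\circ\cdots\circ L_{\sigma(j)}.f_{\sigma(j)}$, where $\sigma$ is any permutation that puts the numbers $l_{i,1}(-1)$ in increasing (not necessarily strictly increasing) order, $l_{i,1}$ being the first factor of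 $L_i$. * For $1\le p\le k+1$, $\mathcal C_{k+1}$ acts on $EC(k,M)$ by $(L,f)\mapsto L^{\pi}_{\sigma(1)}.f_{\sigma(1)}\circ\cdots\circ L^\pi_{\sigma(j)}.f_{\sigma(j)}$, where $L_i^\pi$ is $L_i$ without its $p$-th factor and $\sigma$ is any permutation that puts the numbers $l_{i,p}(-1)$ in increasing order. (Different $p$ give the same action up to a permutation of the coordinates of the cubes.) * $\mathcal C_{n+1}$ acts on $\Omega EC(n-1,M)$ by $(L,F)\mapsto F'_{\sigma(1)}\circ\cdots\circ F'_{\sigma(j)}$ (composition pointwise in the loop coordinate), where $F'_i(t)=(l_{i,2}\times\cdots\times l_{i,n}).F_i(l_{i,1}^{-1}(t))$ and $\sigma$ is any permutation that puts the numbers $l_{i,n+1}(-1)$ in increasing order. An empty composite is the identity. A little $k$-cubes object is a space $X$ with an action of the operad $\mathcal C_k$: continuous maps $\mathcal C_k(j)\times X^j\to X$, $j\ge 0$, satisfying the identity, symmetry and associativity axioms. A map of little $k$-cubes objects is a continuous map between two such objects that commutes with the actions. **Proposition.** The fibre inclusion and the projection in $$EC(n,M)\longrightarrow PEC(n,M)\longrightarrow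 EC(n-1,M)$$ are maps of little $n$-cubes objects, where $EC(n-1,M)$ carries the $\mathcal C_n$-action above with $p=1$ (the pseudo-isotopy coordinate). The graphing map $\mathrm{gr}_1:\Omega EC(n-1,M)\to EC(n,M)$ is a map of little $(n+1)$-cubes objects, where $EC(n,M)$ carries the $\mathcal C_{n+1}$-action above with $p=n+1$. -/

import Mathlib

open scoped Manifold ContDiff

universe u

namespace CubeEmb

/-! ## The weak smooth topology -/

section WeakTopology

/-- The tangent map `Tf : TM → TN` of a smooth map, as a smooth map between tangent bundles. -/
noncomputable def tangentLift {E : Type u} [NormedAddCommGroup E] [NormedSpace ℝ E]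
    {H : Type u} [TopologicalSpace H] {I : ModelWithCorners ℝ E H}
    {M : Type u} [TopologicalSpace M] [ChartedSpace H M] [IsManifold I ∞ M]
    {E' : Type u} [NormedAddCommGroup E'] [NormedSpace ℝ E']
    {H' : Type u} [TopologicalSpace H'] {J : ModelWithCorners ℝ E' H'}
    {N : Type u} [TopologicalSpace N] [ChartedSpace H' N] [IsManifold J ∞ N]
    (f : C^∞⟮I, M; J, N⟯) :
    C^∞⟮I.tangent, TangentBundle I M; J.tangent, TangentBundle J N⟯ :=
  ⟨tangentMap I J f, f.contMDiff.contMDiff_tangentMap (by simp)⟩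

/-- The topology on `C^∞(M, N)` induced by `f ↦ T^k f : T^k M → T^k N` from the compact-open
topology on continuous maps between the `k`-fold iterated tangent bundles. -/
@[reducible] noncomputable def tangentTopology : (k : ℕ) →
    {E : Type u} → [NormedAddCommGroup E] → [NormedSpace ℝ E] →
    {H : Type u} → [TopologicalSpace H] → (I : ModelWithCorners ℝ E H) →
    (M : Type u) → [TopologicalSpace M] → [ChartedSpace H M] → [IsManifold I ∞ M] →
    {E' : Type u} → [NormedAddCommGroup E'] → [NormedSpace ℝ E'] →
    {H' : Type u} → [TopologicalSpace H'] → (J : ModelWithCorners ℝ E' H') →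
    (N : Type u) → [TopologicalSpace N] → [ChartedSpace H' N] → [IsManifold J ∞ N] →
    TopologicalSpace C^∞⟮I, M; J, N⟯
  | 0, _, _, _, _, _, I, M, _, _, _, _, _, _, _, _, J, N, _, _, _ =>
      TopologicalSpace.induced
        (fun f : C^∞⟮I, M; J, N⟯ => (⟨f, f.contMDiff.continuous⟩ : C(M, N))) inferInstance
  | k + 1, _, _, _, _, _, I, M, _, _, _, _, _, _, _, _, J, N, _, _, _ =>
      TopologicalSpace.induced tangentLift
        (tangentTopology k I.tangent (TangentBundle I M) J.tangent (TangentBundle J N))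

/-- The weak `C^∞` topology on `C^∞(M, N)`: the coarsest topology for which all the maps
`f ↦ T^k f`, `k = 0, 1, 2, …`, are continuous into the compact-open topology; that is, the
topology of uniform convergence on compact sets, in charts, of the maps and of each of their
derivatives. -/
@[reducible] noncomputable def weakTopology
    {E : Type u} [NormedAddCommGroup E] [NormedSpace ℝ E]
    {H : Type u} [TopologicalSpace H] (I : ModelWithCorners ℝ E H)
    (M : Type u) [TopologicalSpace M] [ChartedSpace H M] [IsManifold I ∞ M]
    {E' : Type u} [NormedAddCommGroup E'] [NormedSpace ℝ E']
    {H' : Type u} [TopologicalSpace H'] (J : ModelWithCorners ℝ E' H')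
    (N : Type u) [TopologicalSpace N] [ChartedSpace H' N] [IsManifold J ∞ N] :
    TopologicalSpace C^∞⟮I, M; J, N⟯ :=
  ⨅ k : ℕ, tangentTopology k I M J N

end WeakTopology

/-! ## Smooth embeddings -/

section Embeddings

variable {E : Type*} [NormedAddCommGroup E] [NormedSpace ℝ E]
  {H : Type*} [TopologicalSpace H] {I : ModelWithCorners ℝ E H}
  {M : Type*} [TopologicalSpace M] [ChartedSpace H M]
  {E' : Type*} [NormedAddCommGroup E'] [NormedSpace ℝ E']
  {H' : Type*} [TopologicalSpace H'] {J : ModelWithCorners ℝ E' H'}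
  {N : Type*} [TopologicalSpace N] [ChartedSpace H' N]
  {E'' : Type*} [NormedAddCommGroup E''] [NormedSpace ℝ E'']
  {H'' : Type*} [TopologicalSpace H''] {K : ModelWithCorners ℝ E'' H''}
  {P : Type*} [TopologicalSpace P] [ChartedSpace H'' P]

variable (I J) in
/-- A smooth embedding: a smooth topological embedding with injective differentials.  Nothing is
required of the boundary (the boundary need not be sent to the boundary). -/
structure IsSmoothEmb (f : M → N) : Prop where
  smooth : ContMDiff I J ∞ f
  embedding : Topology.IsEmbedding f
  injective_mfderiv : ∀ x, Function.Injective (mfderiv I J f x)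

theorem IsSmoothEmb.comp {g : N → P} {f : M → N} (hg : IsSmoothEmb J K g)
    (hf : IsSmoothEmb I J f) : IsSmoothEmb I K (g ∘ f) where
  smooth := hg.smooth.comp hf.smooth
  embedding := hg.embedding.comp hf.embedding
  injective_mfderiv x := by
    rw [mfderiv_comp x (hg.smooth.mdifferentiable (by simp) _)
      (hf.smooth.mdifferentiable (by simp) _)]
    exact (hg.injective_mfderiv _).comp (hf.injective_mfderiv _)

theorem IsSmoothEmb.of_leftInverse {f : M → N} {g : N → M} (hf : ContMDiff I J ∞ f)
    (hg : ContMDiff J I ∞ g) (h : Function.LeftInverse g f) : IsSmoothEmb I J f where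
  smooth := hf
  embedding := h.isEmbedding hg.continuous hf.continuous
  injective_mfderiv x := by
    have h1 := mfderiv_comp x (hg.mdifferentiable (by simp) (f x))
      (hf.mdifferentiable (by simp) x)
    rw [show g ∘ f = id from funext h, mfderiv_id] at h1
    intro v w hvw
    have hv : v = mfderiv J I g (f x) (mfderiv I J f x v) := DFunLike.congr_fun h1 v
    have hw : w = mfderiv J I g (f x) (mfderiv I J f x w) := DFunLike.congr_fun h1 w
    rw [hv, hw, hvw]

theorem IsSmoothEmb.id : IsSmoothEmb I I (fun x : M => x) :=
  .of_leftInverse contMDiff_id contMDiff_id fun _ => rfl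

/-- An injective continuous self-map that is the identity off a compact set is an embedding. -/
theorem isEmbedding_of_eq_id {X : Type*} [TopologicalSpace X] [T2Space X] {f : X → X}
    (hf : Continuous f) (hinj : Function.Injective f) {C : Set X} (hC : IsCompact C)
    (hid : ∀ x, x ∉ C → f x = x) : Topology.IsEmbedding f := by
  refine (Topology.IsClosedEmbedding.of_continuous_injective_isClosedMap hf hinj
    fun A hA => ?_).isEmbedding
  have h1 : closure (A \ C) ⊆ f '' A := by
    intro x hx
    have hxA : x ∈ A := hA.closure_subset_iff.2 Set.sdiff_subset hx
    have : f x = x := by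
      have hcl : IsClosed {y | f y = y} := isClosed_eq hf continuous_id
      exact hcl.closure_subset_iff.2 (fun y hy => hid y hy.2) hx
    exact ⟨x, hxA, this⟩
  have h2 : f '' A = f '' (A ∩ C) ∪ closure (A \ C) := by
    apply Set.Subset.antisymm
    · rintro _ ⟨x, hx, rfl⟩
      by_cases hxC : x ∈ C
      · exact Or.inl ⟨x, ⟨hx, hxC⟩, rfl⟩
      · right
        rw [hid x hxC]
        exact subset_closure ⟨hx, hxC⟩
    · exact Set.union_subset (Set.image_mono Set.inter_subset_left) h1
  rw [h2]
  exact ((hC.inter_left hA).image hf).isClosed.union isClosed_closure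

end Embeddings

section SelfEmbeddings

/-- Smooth embeddings of a manifold into itself. -/
def SelfEmb {E : Type u} [NormedAddCommGroup E] [NormedSpace ℝ E]
    {H : Type u} [TopologicalSpace H] (I : ModelWithCorners ℝ E H)
    (M : Type u) [TopologicalSpace M] [ChartedSpace H M] : Type u :=
  {f : M → M // IsSmoothEmb I I f}

variable {E : Type u} [NormedAddCommGroup E] [NormedSpace ℝ E]
  {H : Type u} [TopologicalSpace H] {I : ModelWithCorners ℝ E H}
  {M : Type u} [TopologicalSpace M] [ChartedSpace H M]

instance : CoeFun (SelfEmb I M) (fun _ => M → M) := ⟨Subtype.val⟩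

@[ext]
theorem SelfEmb.ext {f g : SelfEmb I M} (h : ∀ x, f x = g x) : f = g := Subtype.ext (funext h)

/-- Self-embeddings form a monoid under composition. -/
noncomputable instance : Monoid (SelfEmb I M) where
  mul f g := ⟨fun x => f (g x), f.2.comp g.2⟩
  one := ⟨fun x => x, .id⟩
  mul_assoc _ _ _ := rfl
  one_mul _ := rfl
  mul_one _ := rfl

@[simp] theorem SelfEmb.mul_apply (f g : SelfEmb I M) (x : M) : (f * g) x = f (g x) := rfl
@[simp] theorem SelfEmb.one_apply (x : M) : (1 : SelfEmb I M) x = x := rfl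

/-- Embedding spaces carry the weak `C^∞` topology. -/
noncomputable instance [IsManifold I ∞ M] : TopologicalSpace (SelfEmb I M) :=
  TopologicalSpace.induced (fun f => (⟨f.1, f.2.smooth⟩ : C^∞⟮I, M; I, M⟯))
    (weakTopology I M I M)

end SelfEmbeddings

/-! ## Little cubes -/

section Cubes

/-- A little `n`-cube `l_1 × ⋯ × l_n`, where `l_i(t) = a_i t + b_i` is increasing and maps
`[-1, 1]` into itself. -/
@[ext]
structure LittleCube (n : ℕ) where
  a : Fin n → ℝ
  b : Fin n → ℝ
  a_pos : ∀ i, 0 < a i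
  lower : ∀ i, -1 ≤ -a i + b i
  upper : ∀ i, a i + b i ≤ 1

namespace LittleCube

variable {n : ℕ}

/-- The affine extension of a little cube to `ℝⁿ`. -/
def map (L : LittleCube n) (x : Fin n → ℝ) : Fin n → ℝ := fun i => L.a i * x i + L.b i

/-- The inverse affine map on `ℝⁿ`. -/
noncomputable def inv (L : LittleCube n) (x : Fin n → ℝ) : Fin n → ℝ :=
  fun i => (x i - L.b i) / L.a i

theorem inv_map (L : LittleCube n) (x) : L.inv (L.map x) = x := by
  funext i
  have := (L.a_pos i).ne'
  simp only [inv, map]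
  field_simp
  ring

theorem map_inv (L : LittleCube n) (x) : L.map (L.inv x) = x := by
  funext i
  have := (L.a_pos i).ne'
  simp only [inv, map]
  field_simp
  ring

/-- The topology given by the coefficients, which is that of the space of maps. -/
instance : TopologicalSpace (LittleCube n) :=
  TopologicalSpace.induced (fun L => (L.a, L.b)) inferInstance

/-- The identity cube. -/
def one : LittleCube n := ⟨fun _ => 1, fun _ => 0, by simp, by simp, by simp⟩

/-- Composition of little cubes. -/
def comp (L L' : LittleCube n) : LittleCube n where
  a i := L.a i * L'.a i
  b i := L.a i * L'.b i + L.b i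
  a_pos i := mul_pos (L.a_pos i) (L'.a_pos i)
  lower i := by nlinarith [L.a_pos i, L.lower i, L'.lower i]
  upper i := by nlinarith [L.a_pos i, L.upper i, L'.upper i]

theorem comp_map (L L' : LittleCube n) (x) : (L.comp L').map x = L.map (L'.map x) := by
  funext i
  simp only [comp, map]
  ring

/-- Delete the `p`-th factor of a little `(n+1)`-cube. -/
def drop (p : Fin (n + 1)) (L : LittleCube (n + 1)) : LittleCube n :=
  ⟨fun i => L.a (p.succAbove i), fun i => L.b (p.succAbove i), fun _ => L.a_pos _,
    fun _ => L.lower _, fun _ => L.upper _⟩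

/-- The bottom `l_p(-1)` of the `p`-th factor `l_p` of a little cube. -/
def bottom (p : Fin n) (L : LittleCube n) : ℝ := L.a p * (-1) + L.b p

/-- The interior `(-1, 1)ⁿ` of the standard cube. -/
def openCube (n : ℕ) : Set (Fin n → ℝ) := {x | ∀ i, x i ∈ Set.Ioo (-1 : ℝ) 1}

theorem map_mem_openCube (L : LittleCube n) {x : Fin n → ℝ} (hx : x ∈ openCube n) :
    L.map x ∈ openCube n := by
  intro i
  have := hx i
  have := L.a_pos i
  have := L.lower i
  have := L.upper i
  simp only [Set.mem_Ioo, map] at *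
  constructor <;> nlinarith

end LittleCube

open LittleCube

/-- `𝒞_n(j)`: the space of `j`-tuples of little `n`-cubes with pairwise disjoint interiors. -/
def Cubes (n j : ℕ) : Type :=
  {L : Fin j → LittleCube n //
    ∀ i k, i ≠ k → Disjoint ((L i).map '' openCube n) ((L k).map '' openCube n)}

namespace Cubes

variable {n j : ℕ}

instance : TopologicalSpace (Cubes n j) := inferInstanceAs (TopologicalSpace (Subtype _))

instance : CoeFun (Cubes n j) (fun _ => Fin j → LittleCube n) := ⟨Subtype.val⟩

/-- The identity of the operad of little `n`-cubes. -/
def one : Cubes n 1 := ⟨fun _ => LittleCube.one, fun _ _ h => (h (Subsingleton.elim _ _)).elim⟩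

/-- The action of the symmetric group. -/
def perm (L : Cubes n j) (σ : Equiv.Perm (Fin j)) : Cubes n j :=
  ⟨fun i => L (σ i), fun _ _ h => L.2 _ _ (σ.injective.ne h)⟩

/-- The operad composition `𝒞_n(m) × 𝒞_n(j_1) × ⋯ × 𝒞_n(j_m) → 𝒞_n(j_1 + ⋯ + j_m)`. -/
def comp {m : ℕ} {j : Fin m → ℕ} (L : Cubes n m) (L' : ∀ i, Cubes n (j i)) :
    Cubes n (∑ i, j i) :=
  ⟨fun q => (L (finSigmaFinEquiv.symm q).1).comp
      (L' (finSigmaFinEquiv.symm q).1 (finSigmaFinEquiv.symm q).2), by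
    have key : ∀ q q' : (i : Fin m) × Fin (j i), q ≠ q' →
        Disjoint (((L q.1).comp (L' q.1 q.2)).map '' openCube n)
          (((L q'.1).comp (L' q'.1 q'.2)).map '' openCube n) := by
      rintro ⟨i, p⟩ ⟨i', p'⟩ hne
      rw [Set.disjoint_left]
      rintro _ ⟨x, hx, rfl⟩ ⟨y, hy, hxy⟩
      simp only [comp_map] at hxy
      by_cases hi : i = i'
      · subst hi
        have hp : p ≠ p' := fun h => hne (by rw [h])
        have h1 := congrArg (L i).inv hxy
        rw [inv_map, inv_map] at h1
        exact Set.disjoint_left.1 ((L' i).2 p p' hp) ⟨x, hx, rfl⟩ ⟨y, hy, h1⟩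
      · exact Set.disjoint_left.1 (L.2 i i' hi) ⟨_, map_mem_openCube _ hx, rfl⟩
          ⟨_, map_mem_openCube _ hy, hxy⟩
    intro q q' hqq'
    exact key _ _ (finSigmaFinEquiv.symm.injective.ne hqq')⟩

end Cubes

/-- `X` with the maps `κ_j : 𝒞_n(j) × X^j → X` is a little `n`-cubes object: these maps define an
action of the operad of little `n`-cubes on the space `X`. -/
structure IsCubesObject (n : ℕ) {X : Type*} [TopologicalSpace X]
    (κ : (j : ℕ) → Cubes n j → (Fin j → X) → X) : Prop where
  continuous : ∀ j, Continuous fun p : Cubes n j × (Fin j → X) => κ j p.1 p.2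
  identity : ∀ x : X, κ 1 Cubes.one (fun _ => x) = x
  symmetry : ∀ (j : ℕ) (L : Cubes n j) (σ : Equiv.Perm (Fin j)) (x : Fin j → X),
    κ j (L.perm σ) (fun i => x (σ i)) = κ j L x
  associativity : ∀ (m : ℕ) (j : Fin m → ℕ) (L : Cubes n m) (L' : ∀ i, Cubes n (j i))
    (x : ∀ i, Fin (j i) → X),
    κ (∑ i, j i) (L.comp L')
        (fun q => x (finSigmaFinEquiv.symm q).1 (finSigmaFinEquiv.symm q).2) =
      κ m L (fun i => κ (j i) (L' i) (x i))

/-- `φ` is a map of little `n`-cubes objects from `(X, κ)` to `(Y, κ')`: both are little `n`-cubes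
objects, and `φ` is continuous and commutes with the actions. -/
structure IsCubesMap (n : ℕ) {X Y : Type*} [TopologicalSpace X] [TopologicalSpace Y]
    (κ : (j : ℕ) → Cubes n j → (Fin j → X) → X) (κ' : (j : ℕ) → Cubes n j → (Fin j → Y) → Y)
    (φ : X → Y) : Prop where
  source : IsCubesObject n κ
  target : IsCubesObject n κ'
  continuous : Continuous φ
  equivariant : ∀ (j : ℕ) (L : Cubes n j) (x : Fin j → X),
    φ (κ j L x) = κ' j L (fun i => φ (x i))

/-- The product `x_{σ(1)} ⋯ x_{σ(j)}` where `σ` is a permutation such that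
`t_{σ(1)} ≤ ⋯ ≤ t_{σ(j)}` (ties are broken by the index; in an operad action the result does not
depend on the choice, by symmetry). -/
noncomputable def orderedProd {j : ℕ} {X : Type*} [Monoid X] (t : Fin j → ℝ) (x : Fin j → X) : X :=
  (List.ofFn fun i => x (Tuple.sort t i)).prod

end Cubes

/-! ## The spaces `EC(n, M)`, `PEC(n, M)` and `Ω EC(n, M)` -/

section Spaces

variable {E : Type u} [NormedAddCommGroup E] [NormedSpace ℝ E]
  {H : Type u} [TopologicalSpace H] {I : ModelWithCorners ℝ E H}
  {M : Type u} [TopologicalSpace M] [ChartedSpace H M]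

variable (I) in
/-- The model of the manifold `ℝⁿ × M`. -/
noncomputable abbrev model (n : ℕ) : ModelWithCorners ℝ ((Fin n → ℝ) × E) (ModelProd (Fin n → ℝ) H) :=
  𝓘(ℝ, Fin n → ℝ).prod I

variable (I M) in
/-- `EC(n, M)`: the embeddings of `ℝⁿ × M` into itself with support in `[-1, 1]ⁿ × M`, as a
submonoid (under composition) of all self-embeddings. -/
noncomputable def EC (n : ℕ) : Submonoid (SelfEmb (model I n) ((Fin n → ℝ) × M)) where
  carrier := {f | ∀ x, f x ≠ x → ∀ i, x.1 i ∈ Set.Icc (-1 : ℝ) 1}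
  one_mem' x h := (h rfl).elim
  mul_mem' {f g} hf hg x h := by
    by_cases hx : g x = x
    · exact hf x fun h' => h (by rw [SelfEmb.mul_apply, hx, h'])
    · exact hg x hx

variable (I M) in
/-- `PEC(n+1, M)`: the embeddings `f` of `ℝⁿ⁺¹ × M` into itself with support in
`[-1, ∞) × [-1, 1]ⁿ × M` for which there is `g ∈ EC(n, M)` with
`f(t_1, t_2, …, t_{n+1}, m) = (t_1, g(t_2, …, t_{n+1}, m))` whenever `t_1 ≥ 1`. -/
noncomputable def PEC (n : ℕ) : Submonoid (SelfEmb (model I (n + 1)) ((Fin (n + 1) → ℝ) × M)) where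
  carrier := {f |
    (∀ x, f x ≠ x → -1 ≤ x.1 0 ∧ ∀ i : Fin n, x.1 i.succ ∈ Set.Icc (-1 : ℝ) 1) ∧
    ∃ g ∈ EC I M n, ∀ (t : ℝ) (y : (Fin n → ℝ) × M), 1 ≤ t →
      f (Fin.cons t y.1, y.2) = (Fin.cons t (g y).1, (g y).2)}
  one_mem' := ⟨fun x h => (h rfl).elim, 1, one_mem _, fun _ _ _ => rfl⟩
  mul_mem' := by
    rintro f f' ⟨hf, g, hg, hfg⟩ ⟨hf', g', hg', hfg'⟩
    refine ⟨fun x h => ?_, g * g', mul_mem hg hg', fun t y ht => ?_⟩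
    · by_cases hx : f' x = x
      · exact hf x fun h' => h (by rw [SelfEmb.mul_apply, hx, h'])
      · exact hf' x hx
    · rw [SelfEmb.mul_apply, hfg' t y ht, hfg t (g' y) ht, SelfEmb.mul_apply]

/-! ### The action of little cubes on embeddings by conjugation -/

theorem contMDiff_affine {n : ℕ} (A : (Fin n → ℝ) → Fin n → ℝ) (hA : ContDiff ℝ ∞ A) :
    ContMDiff (model I n) (model I n) ∞ (fun x : (Fin n → ℝ) × M => (A x.1, x.2)) :=
  (hA.contMDiff.comp contMDiff_fst).prodMk contMDiff_snd

theorem contDiff_map {n : ℕ} (L : LittleCube n) : ContDiff ℝ ∞ L.map := by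
  unfold LittleCube.map
  fun_prop

theorem contDiff_inv {n : ℕ} (L : LittleCube n) : ContDiff ℝ ∞ L.inv := by
  unfold LittleCube.inv
  simp only [div_eq_mul_inv]
  fun_prop

/-- `L.f = (L × Id_M) ∘ f ∘ (L⁻¹ × Id_M)`. -/
noncomputable def conj {n : ℕ} (L : LittleCube n) (f : SelfEmb (model I n) ((Fin n → ℝ) × M)) :
    SelfEmb (model I n) ((Fin n → ℝ) × M) :=
  ⟨fun x => (L.map (f (L.inv x.1, x.2)).1, (f (L.inv x.1, x.2)).2), by
    have h1 : IsSmoothEmb (model I n) (model I n)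
        (fun x : (Fin n → ℝ) × M => (L.map x.1, x.2)) :=
      .of_leftInverse (contMDiff_affine _ (contDiff_map L)) (contMDiff_affine _ (contDiff_inv L))
        fun x => by simp [L.inv_map]
    have h2 : IsSmoothEmb (model I n) (model I n)
        (fun x : (Fin n → ℝ) × M => (L.inv x.1, x.2)) :=
      .of_leftInverse (contMDiff_affine _ (contDiff_inv L)) (contMDiff_affine _ (contDiff_map L))
        fun x => by simp [L.map_inv]
    exact h1.comp (f.2.comp h2)⟩

theorem conj_apply {n : ℕ} (L : LittleCube n) (f : SelfEmb (model I n) ((Fin n → ℝ) × M)) (x) :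
    conj L f x = (L.map (f (L.inv x.1, x.2)).1, (f (L.inv x.1, x.2)).2) := rfl

theorem conj_ne {n : ℕ} {L : LittleCube n} {f : SelfEmb (model I n) ((Fin n → ℝ) × M)}
    {x : (Fin n → ℝ) × M}
    (h : conj L f x ≠ x) : f (L.inv x.1, x.2) ≠ (L.inv x.1, x.2) := by
  intro h'
  apply h
  rw [conj_apply, h']
  simp [L.map_inv]

theorem inv_lower {n : ℕ} (L : LittleCube n) (x : Fin n → ℝ) (i : Fin n)
    (h : -1 ≤ L.inv x i) : -1 ≤ x i := by
  simp only [LittleCube.inv] at h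
  rw [le_div_iff₀ (L.a_pos i)] at h
  linarith [L.lower i]

theorem inv_upper {n : ℕ} (L : LittleCube n) (x : Fin n → ℝ) (i : Fin n)
    (h : L.inv x i ≤ 1) : x i ≤ 1 := by
  simp only [LittleCube.inv] at h
  rw [div_le_iff₀ (L.a_pos i)] at h
  linarith [L.upper i]

/-- The action `L.f` on `EC(n, M)`. -/
noncomputable def EC.act {n : ℕ} (L : LittleCube n) (f : EC I M n) : EC I M n :=
  ⟨conj L f.1, fun x h i =>
    ⟨inv_lower L _ _ (f.2 _ (conj_ne h) i).1, inv_upper L _ _ (f.2 _ (conj_ne h) i).2⟩⟩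

theorem inv_cons {n : ℕ} (L : LittleCube (n + 1)) (t : ℝ) (y : Fin n → ℝ) :
    L.inv (Fin.cons t y) = Fin.cons ((t - L.b 0) / L.a 0) ((L.drop 0).inv y) := by
  funext i
  refine Fin.cases ?_ (fun i => ?_) i <;> simp [LittleCube.inv, LittleCube.drop]

theorem map_cons {n : ℕ} (L : LittleCube (n + 1)) (t : ℝ) (y : Fin n → ℝ) :
    L.map (Fin.cons t y) = Fin.cons (L.a 0 * t + L.b 0) ((L.drop 0).map y) := by
  funext i
  refine Fin.cases ?_ (fun i => ?_) i <;> simp [LittleCube.map, LittleCube.drop]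

/-- The action `L.f` on `PEC(n+1, M)`. -/
noncomputable def PEC.act {n : ℕ} (L : LittleCube (n + 1)) (f : PEC I M n) : PEC I M n :=
  ⟨conj L f.1, by
    obtain ⟨f, hf, g, hg, hfg⟩ := f
    refine ⟨fun x h => ?_, (EC.act (L.drop 0) ⟨g, hg⟩).1, (EC.act (L.drop 0) ⟨g, hg⟩).2,
      fun t y ht => ?_⟩
    · have h' := hf _ (conj_ne h)
      exact ⟨inv_lower L _ _ h'.1,
        fun i => ⟨inv_lower L _ _ (h'.2 i).1, inv_upper L _ _ (h'.2 i).2⟩⟩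
    · have ha := L.a_pos 0
      have ht' : 1 ≤ (t - L.b 0) / L.a 0 := by
        rw [le_div_iff₀ ha]
        linarith [L.upper 0]
      have := hfg _ ((L.drop 0).inv y.1, y.2) ht'
      simp only [conj_apply, inv_cons, this, map_cons, EC.act]
      congr 2
      field_simp
      ring⟩

/-! ### The actions of the operads of little cubes -/

/-- The concatenation action of the little `n`-cubes on `EC(n, M)`:
`(L, f) ↦ L_1.f_1 ∘ ⋯ ∘ L_j.f_j`. -/
noncomputable def EC.concat (n j : ℕ) (L : Cubes n j) (f : Fin j → EC I M n) : EC I M n :=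
  (List.ofFn fun i => EC.act (L i) (f i)).prod

/-- The action of the little `(n+1)`-cubes on `EC(n, M)` for which the `p`-th factor of the cubes
gives the order of composition: `(L, f) ↦ L^π_{σ(1)}.f_{σ(1)} ∘ ⋯ ∘ L^π_{σ(j)}.f_{σ(j)}`, where
`L^π` is `L` without its `p`-th factor, and `L^t_{σ(1)} ≤ ⋯ ≤ L^t_{σ(j)}` with `L^t = l_p(-1)`. -/
noncomputable def EC.kappa {n : ℕ} (p : Fin (n + 1)) (j : ℕ) (L : Cubes (n + 1) j)
    (f : Fin j → EC I M n) : EC I M n :=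
  orderedProd (fun i => (L i).bottom p) (fun i => EC.act ((L i).drop p) (f i))

/-- The action of the little `(n+1)`-cubes on `PEC(n+1, M)`:
`(L, f) ↦ L_{σ(1)}.f_{σ(1)} ∘ ⋯ ∘ L_{σ(j)}.f_{σ(j)}`, where `L^t_{σ(1)} ≤ ⋯ ≤ L^t_{σ(j)}` and
`L^t = l_1(-1)` is the bottom of the factor of `L` in the pseudo-isotopy direction. -/
noncomputable def PEC.kappa {n : ℕ} (j : ℕ) (L : Cubes (n + 1) j)
    (f : Fin j → PEC I M n) : PEC I M n :=
  orderedProd (fun i => (L i).bottom 0) (fun i => PEC.act (L i) (f i))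

/-! ### The fibre inclusion and the projection -/

/-- An element of `EC(n+1, M)` is the identity on `[1, ∞) × ℝⁿ × M`. -/
theorem EC.eq_of_one_le {n : ℕ} (f : EC I M (n + 1)) (t : ℝ) (ht : 1 ≤ t) (y : (Fin n → ℝ) × M)
    [T2Space M] : f.1 (Fin.cons t y.1, y.2) = (Fin.cons t y.1, y.2) := by
  have hc : Continuous fun s : ℝ => ((Fin.cons s y.1, y.2) : (Fin (n + 1) → ℝ) × M) := by
    refine Continuous.prodMk (continuous_pi fun i => ?_) continuous_const
    refine Fin.cases ?_ (fun i => ?_) i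
    · simpa using continuous_id'
    · simpa using continuous_const
  have hcl : IsClosed {s : ℝ | f.1 (Fin.cons s y.1, y.2) = (Fin.cons s y.1, y.2)} :=
    isClosed_eq (f.1.2.smooth.continuous.comp hc) hc
  have hsub : Set.Ioi (1 : ℝ) ⊆ {s : ℝ | f.1 (Fin.cons s y.1, y.2) = (Fin.cons s y.1, y.2)} := by
    intro s hs
    by_contra hne
    have := (f.2 _ hne 0).2
    simp only [Fin.cons_zero] at this
    exact absurd hs (not_lt.2 this)
  have := hcl.closure_subset_iff.2 hsub
  rw [closure_Ioi] at this
  exact this ht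

/-- The fibre inclusion `EC(n+1, M) → PEC(n+1, M)`. -/
noncomputable def incl [T2Space M] {n : ℕ} (f : EC I M (n + 1)) : PEC I M n :=
  ⟨f.1, fun x h => ⟨(f.2 x h 0).1, fun i => f.2 x h i.succ⟩, 1, one_mem _,
    fun t y ht => EC.eq_of_one_le f t ht y⟩

/-- The projection `PEC(n+1, M) → EC(n, M)`: restriction to `{1} × ℝⁿ × M`, which is identified
with `ℝⁿ × M`. -/
noncomputable def proj {n : ℕ} (f : PEC I M n) : EC I M n :=
  let r : (Fin n → ℝ) × M → (Fin n → ℝ) × M := fun y =>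
    (Fin.tail (f.1 (Fin.cons 1 y.1, y.2)).1, (f.1 (Fin.cons 1 y.1, y.2)).2)
  have h : ∃ g ∈ EC I M n, g.1 = r := by
    obtain ⟨g, hg, hfg⟩ := f.2.2
    refine ⟨g, hg, funext fun y => ?_⟩
    simp only [r, hfg 1 y le_rfl, Fin.tail_cons]
  ⟨⟨r, by obtain ⟨g, _, hgr⟩ := h; exact hgr ▸ g.2⟩, by
    obtain ⟨g, hg, hgr⟩ := h
    intro x hx
    apply hg x
    rw [hgr]
    exact hx⟩

/-! ### Loops and the graphing map -/

variable (I M) in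
/-- The smooth loops in `EC(n, M)`, as a submonoid of all functions `ℝ → EC(n, M)` under pointwise
composition. -/
noncomputable def loopSubmonoid (n : ℕ) : Submonoid (ℝ → EC I M n) where
  carrier := {F |
    ContMDiff (𝓘(ℝ).prod (model I n)) (model I n) ∞
      (fun p : ℝ × ((Fin n → ℝ) × M) => (F p.1).1 p.2) ∧
    ∀ t ∉ Set.Icc (-1 : ℝ) 1, F t = 1}
  one_mem' := ⟨contMDiff_snd, fun _ _ => rfl⟩
  mul_mem' := by
    rintro F G ⟨hF, hF'⟩ ⟨hG, hG'⟩
    refine ⟨hF.comp (contMDiff_fst.prodMk hG), fun t ht => ?_⟩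
    rw [Pi.mul_apply, hF' t ht, hG' t ht, one_mul]

variable (I M) in
/-- `Ω EC(n, M)`: the smooth functions `F : ℝ → EC(n, M)` with `F(t) = Id` for `t ∉ [-1, 1]`.
Smoothness of `F` is that of `(t, x) ↦ F(t)(x)`, `ℝ × (ℝⁿ × M) → ℝⁿ × M`. -/
def Loops (n : ℕ) : Type u := loopSubmonoid I M n

noncomputable instance (n : ℕ) : Monoid (Loops I M n) :=
  inferInstanceAs (Monoid (loopSubmonoid I M n))

instance (n : ℕ) : CoeFun (Loops I M n) (fun _ => ℝ → EC I M n) := ⟨Subtype.val⟩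

/-- The weak `C^∞` topology on smooth loops, through the smooth maps
`(t, x) ↦ F(t)(x)`, `ℝ × (ℝⁿ × M) → ℝⁿ × M`. -/
noncomputable instance [IsManifold I ∞ M] (n : ℕ) : TopologicalSpace (Loops I M n) :=
  TopologicalSpace.induced
    (fun F => (⟨fun p => (F p.1).1 p.2, F.2.1⟩ :
      C^∞⟮𝓘(ℝ).prod (model I n), ℝ × ((Fin n → ℝ) × M); model I n, (Fin n → ℝ) × M⟯))
    (weakTopology _ _ _ _)

/-- For a little `(n+2)`-cube `L`, with `L^α` its first factor, `L^β` the product of the other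
factors and `L^{βπ}` that of all of them but the last, the loop `L^{βπ}.L^α.F`: the loop `F` is
reparametrised by `L^α`, and its values are acted on by `L^{βπ}`. -/
noncomputable def Loops.act {n : ℕ} (L : LittleCube (n + 2)) (F : Loops I M n) : Loops I M n :=
  ⟨fun t => EC.act ((L.drop 0).drop (Fin.last n)) (F ((t - L.b 0) / L.a 0)), by
    constructor
    · have hA : ContMDiff 𝓘(ℝ) 𝓘(ℝ) ∞ (fun t : ℝ => (t - L.b 0) / L.a 0) := by
        apply ContDiff.contMDiff
        simp only [div_eq_mul_inv]
        fun_prop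
      exact (contMDiff_affine _ (contDiff_map _)).comp (F.2.1.comp
        ((hA.comp contMDiff_fst).prodMk
          ((contMDiff_affine _ (contDiff_inv _)).comp contMDiff_snd)))
    · intro t ht
      have ht' : (t - L.b 0) / L.a 0 ∉ Set.Icc (-1 : ℝ) 1 := by
        intro h
        apply ht
        rw [Set.mem_Icc, le_div_iff₀ (L.a_pos 0), div_le_iff₀ (L.a_pos 0)] at h
        constructor <;> linarith [L.lower 0, L.upper 0]
      have h1 : F ((t - L.b 0) / L.a 0) = 1 := F.2.2 _ ht'
      have h2 (K : LittleCube n) : EC.act K (1 : EC I M n) = 1 := by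
        apply Subtype.ext
        apply SelfEmb.ext
        intro x
        change conj _ 1 x = x
        rw [conj_apply]
        simp [LittleCube.map_inv]
      exact (congrArg _ h1).trans (h2 _)⟩

/-- The action of the little `(n+2)`-cubes on `Ω EC(n, M)`:
`(L, F) ↦ L^{βπ}_{σ(1)}.L^α_{σ(1)}.F_{σ(1)} ∘ ⋯ ∘ L^{βπ}_{σ(j)}.L^α_{σ(j)}.F_{σ(j)}`, where
`L^{βt}_{σ(1)} ≤ ⋯ ≤ L^{βt}_{σ(j)}` and `L^{βt}` is the bottom of the last factor of `L`. -/
noncomputable def Loops.kappa {n : ℕ} (j : ℕ) (L : Cubes (n + 2) j)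
    (F : Fin j → Loops I M n) : Loops I M n :=
  orderedProd (fun i => ((L i).drop 0).bottom (Fin.last n)) (fun i => Loops.act (L i) (F i))

/-- The function `(t_0, t, v) ↦ (t_0, F(t_0)(t, v))`. -/
noncomputable def graphFun {n : ℕ} (F : Loops I M n) (x : (Fin (n + 1) → ℝ) × M) :
    (Fin (n + 1) → ℝ) × M :=
  (Fin.cons (x.1 0) ((F (x.1 0)).1 (Fin.tail x.1, x.2)).1, ((F (x.1 0)).1 (Fin.tail x.1, x.2)).2)

theorem contMDiff_tail {n : ℕ} : ContMDiff (model I (n + 1)) (model I n) ∞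
    (fun x : (Fin (n + 1) → ℝ) × M => (Fin.tail x.1, x.2)) := by
  have hA : ContDiff ℝ ∞ (fun x : Fin (n + 1) → ℝ => Fin.tail x) := by
    unfold Fin.tail
    fun_prop
  exact (hA.contMDiff.comp contMDiff_fst).prodMk contMDiff_snd

theorem contDiff_cons {n : ℕ} :
    ContDiff ℝ ∞ (fun x : ℝ × (Fin n → ℝ) => (Fin.cons x.1 x.2 : Fin (n + 1) → ℝ)) := by
  rw [contDiff_pi]
  intro i
  refine Fin.cases ?_ (fun i => ?_) i
  · simpa using contDiff_fst
  · simp only [Fin.cons_succ]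
    fun_prop

theorem contMDiff_graphFun {n : ℕ} (F : Loops I M n) :
    ContMDiff (model I (n + 1)) (model I (n + 1)) ∞ (graphFun F) := by
  have h0 : ContMDiff (model I (n + 1)) 𝓘(ℝ) ∞ (fun x : (Fin (n + 1) → ℝ) × M => x.1 0) := by
    have hA : ContDiff ℝ ∞ (fun x : Fin (n + 1) → ℝ => x 0) := by fun_prop
    exact hA.contMDiff.comp contMDiff_fst
  have hF : ContMDiff (model I (n + 1)) (model I n) ∞
      (fun x : (Fin (n + 1) → ℝ) × M => (F (x.1 0)).1 (Fin.tail x.1, x.2)) :=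
    F.2.1.comp (h0.prodMk contMDiff_tail)
  refine ContMDiff.prodMk ?_ hF.snd
  exact contDiff_cons.contMDiff.comp (h0.prodMk_space hF.fst)

theorem graphFun_injective {n : ℕ} (F : Loops I M n) : Function.Injective (graphFun F) := by
  intro x y h
  simp only [graphFun, Prod.mk.injEq, Fin.cons_inj] at h
  obtain ⟨⟨h0, h1⟩, h2⟩ := h
  rw [← h0] at h1 h2
  have := (F (x.1 0)).1.2.embedding.injective (Prod.ext h1 h2)
  simp only [Prod.mk.injEq] at this
  refine Prod.ext ?_ this.2
  rw [← Fin.cons_self_tail x.1, ← Fin.cons_self_tail y.1, h0, this.1]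

theorem graphFun_support {n : ℕ} (F : Loops I M n) (x) (h : graphFun F x ≠ x) (i) :
    x.1 i ∈ Set.Icc (-1 : ℝ) 1 := by
  have h0 : x.1 0 ∈ Set.Icc (-1 : ℝ) 1 := by
    by_contra hx
    apply h
    simp only [graphFun, F.2.2 _ hx]
    change (Fin.cons (x.1 0) (Fin.tail x.1), x.2) = x
    rw [Fin.cons_self_tail]
  refine Fin.cases h0 (fun i => ?_) i
  refine (F (x.1 0)).2 (Fin.tail x.1, x.2) (fun hx => h ?_) i
  simp only [graphFun, hx, Fin.cons_self_tail]

theorem graphFun_mfderiv {n : ℕ} (F : Loops I M n) (x : (Fin (n + 1) → ℝ) × M) :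
    Function.Injective (mfderiv (model I (n + 1)) (model I (n + 1)) (graphFun F) x) := by
  rw [injective_iff_map_eq_zero]
  intro w hw
  set t₀ := x.1 0 with ht₀
  -- the projection to the first coordinate is preserved by the graph
  let c : (Fin (n + 1) → ℝ) × M → ℝ := fun y => y.1 0
  let c' : (Fin (n + 1) → ℝ) →L[ℝ] ℝ := ContinuousLinearMap.proj 0
  have hc (y) : HasMFDerivAt (model I (n + 1)) 𝓘(ℝ) c y
      (c'.comp (ContinuousLinearMap.fst ℝ (Fin (n + 1) → ℝ) E)) :=
    (c'.hasFDerivAt.hasMFDerivAt (x := y.1)).comp y (hasMFDerivAt_fst y)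
  have hg := ((contMDiff_graphFun F).mdifferentiable (by simp) x).hasMFDerivAt
  have hw0 : w.1 0 = 0 := by
    have h1 := (hc (graphFun F x)).comp x hg
    have h2 : c ∘ graphFun F = c := by
      funext y
      simp [c, graphFun]
    rw [h2] at h1
    have h3 := DFunLike.congr_fun (hasMFDerivAt_unique (hc x) h1) w
    change w.1 0 = c' (mfderiv (model I (n + 1)) (model I (n + 1)) (graphFun F) x w).1 at h3
    rw [h3, hw]
    rfl
  -- the slice of the graph at time `t₀` is the embedding `F t₀`
  let q : (Fin (n + 1) → ℝ) × M → (Fin n → ℝ) × M := fun y => (Fin.tail y.1, y.2)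
  let s : (Fin n → ℝ) × M → (Fin (n + 1) → ℝ) × M := fun y => (Fin.cons t₀ y.1, y.2)
  have hsq : s (q x) = x := by simp [s, q, ht₀]
  let tl : (Fin (n + 1) → ℝ) →L[ℝ] (Fin n → ℝ) :=
    ContinuousLinearMap.pi fun i => ContinuousLinearMap.proj i.succ
  let cn : (Fin n → ℝ) →L[ℝ] (Fin (n + 1) → ℝ) :=
    ContinuousLinearMap.pi (Fin.cases 0 fun i => ContinuousLinearMap.proj i)
  have htl (y) : HasFDerivAt (fun y : Fin (n + 1) → ℝ => Fin.tail y) tl y := tl.hasFDerivAt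
  have hcn (y) : HasFDerivAt (fun y : Fin n → ℝ => (Fin.cons t₀ y : Fin (n + 1) → ℝ)) cn y := by
    rw [hasFDerivAt_pi]
    intro i
    refine Fin.cases ?_ (fun i => ?_) i
    · simpa using hasFDerivAt_const t₀ y
    · exact hasFDerivAt_apply (𝕜 := ℝ) (F' := fun _ : Fin n => ℝ) i y
  have hq (y) : HasMFDerivAt (model I (n + 1)) (model I n) q y
      ((tl.comp (ContinuousLinearMap.fst ℝ (Fin (n + 1) → ℝ) E)).prod
        (ContinuousLinearMap.snd ℝ (Fin (n + 1) → ℝ) E)) :=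
    ((htl y.1).hasMFDerivAt.comp y (hasMFDerivAt_fst y)).prodMk (hasMFDerivAt_snd y)
  have hs (y) : HasMFDerivAt (model I n) (model I (n + 1)) s y
      ((cn.comp (ContinuousLinearMap.fst ℝ (Fin n → ℝ) E)).prod
        (ContinuousLinearMap.snd ℝ (Fin n → ℝ) E)) :=
    ((hcn y.1).hasMFDerivAt.comp y (hasMFDerivAt_fst y)).prodMk (hasMFDerivAt_snd y)
  let D : ((Fin (n + 1) → ℝ) × E) →L[ℝ] ((Fin (n + 1) → ℝ) × E) :=
    mfderiv (model I (n + 1)) (model I (n + 1)) (graphFun F) (s (q x))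
  have hg' : HasMFDerivAt (model I (n + 1)) (model I (n + 1)) (graphFun F) (s (q x)) D :=
    ((contMDiff_graphFun F).mdifferentiable (by simp) _).hasMFDerivAt
  have hcomp := (hq (graphFun F (s (q x)))).comp (q x) (hg'.comp (q x) (hs (q x)))
  have hFt : q ∘ graphFun F ∘ s = (F t₀).1.1 := by
    funext y
    simp [q, s, graphFun]
  rw [hFt] at hcomp
  -- the vector `w` is tangent to the slice
  let w' : (Fin n → ℝ) × E := (Fin.tail (show (Fin (n + 1) → ℝ) × E from w).1, w.2)
  have hw' : (cn w'.1, w'.2) = (show (Fin (n + 1) → ℝ) × E from w) := by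
    refine Prod.ext (funext fun i => ?_) rfl
    refine Fin.cases ?_ (fun i => rfl) i
    exact hw0.symm
  have hD : D (cn w'.1, w'.2) = 0 := by
    rw [hw']
    have : ∀ z, z = x → mfderiv (model I (n + 1)) (model I (n + 1)) (graphFun F) z w = 0 := by
      rintro _ rfl
      exact hw
    exact this _ hsq
  have hzero : w' = 0 := by
    apply (F t₀).1.2.injective_mfderiv (q x)
    refine Eq.trans (DFunLike.congr_fun hcomp.mfderiv w') ?_
    refine Eq.trans ?_ (map_zero (mfderiv (model I n) (model I n) (F t₀).1.1 (q x))).symm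
    change (tl (D (cn w'.1, w'.2)).1, (D (cn w'.1, w'.2)).2) = (0 : (Fin n → ℝ) × E)
    rw [hD]
    simp
  have : (show (Fin (n + 1) → ℝ) × E from w) = 0 := by
    rw [← hw', hzero]
    simp
  exact this

theorem graphFun_isSmoothEmb [CompactSpace M] [T2Space M] {n : ℕ} (F : Loops I M n) :
    IsSmoothEmb (model I (n + 1)) (model I (n + 1)) (graphFun F) where
  smooth := contMDiff_graphFun F
  embedding := by
    refine isEmbedding_of_eq_id (contMDiff_graphFun F).continuous (graphFun_injective F)
      (C := Set.Icc (-1) 1 ×ˢ Set.univ) (isCompact_Icc.prod isCompact_univ) fun x hx => ?_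
    by_contra h
    have := graphFun_support F x h
    exact hx ⟨⟨fun i => (this i).1, fun i => (this i).2⟩, trivial⟩
  injective_mfderiv := graphFun_mfderiv F

/-- The graphing map `gr_1 : Ω EC(n, M) → EC(n+1, M)`. -/
noncomputable def gr [CompactSpace M] [T2Space M] {n : ℕ} (F : Loops I M n) : EC I M (n + 1) :=
  ⟨⟨graphFun F, graphFun_isSmoothEmb F⟩, graphFun_support F⟩

end Spaces

end CubeEmb

/-!
The three maps are homomorphisms of monoids under composition, and each intertwines the conjugation
by single little cubes; hence they commute with the ordered products that define the actions
(`incl_concat`, `proj_kappa`, `gr_kappa`).  The work lies in showing that the four structures are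
actions of the operad of little cubes by continuous maps.

*Continuity.*  The weak topology is defined through iterated tangent maps.  Since `T(g ∘ f)` is
`Tg ∘ Tf`, `T(f, g)` is `(Tf, Tg)` and the tangent map of a constant is constant, an induction on the
number of tangent bundles shows that composition, pairing and the formation of constant maps are
continuous (`continuous_tangentTopology_comp`, `continuous_tangentTopology_prodMk`,
`continuous_tangentTopology_const`).  Therefore a smooth family of maps depends continuously on its
parameters (`continuous_weakTopology_family`), and `L.f` is continuous in `(L, f)`
(`continuous_conj`).

*Operad axioms.*  The actions on `EC(n, M)` through the `p`-th factor and on `PEC(n+1, M)` are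
instances of `IsOrderedAction`: the cubes act on a topological monoid by endomorphisms, and the
images of two cubes commute as soon as the cubes are disjoint after their `p`-th factors are removed.
Disjoint cubes whose `p`-th factors overlap are of this kind (`LittleCube.disjoint_drop`).  So, of
two factors in an ordered product, only commuting ones ever change places: when heights agree, which
gives symmetry and continuity, and when the bottoms of nested cubes interleave, which gives
associativity.  The lemma behind all of this is `prod_map_eq_of_perm`.

*Transfer.*  The fibre inclusion and the graphing map are injective and induce the topologies of
their sources, so that the structures on `EC(n+1, M)` (concatenation) and `Ω EC(n, M)` are pulled back
from those of their targets by `IsCubesObject.of_injective`.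
-/

namespace CubeEmb

open scoped Topology

/-! ### Operations on smooth maps in the weak topology -/

section WeakTopology

variable {E : Type u} [NormedAddCommGroup E] [NormedSpace ℝ E]
  {H : Type u} [TopologicalSpace H] {I : ModelWithCorners ℝ E H}
  {M : Type u} [TopologicalSpace M] [ChartedSpace H M] [IsManifold I ∞ M]
  {E' : Type u} [NormedAddCommGroup E'] [NormedSpace ℝ E']
  {H' : Type u} [TopologicalSpace H'] {J : ModelWithCorners ℝ E' H'}
  {N : Type u} [TopologicalSpace N] [ChartedSpace H' N] [IsManifold J ∞ N]
  {E'' : Type u} [NormedAddCommGroup E''] [NormedSpace ℝ E'']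
  {H'' : Type u} [TopologicalSpace H''] {K : ModelWithCorners ℝ E'' H''}
  {P : Type u} [TopologicalSpace P] [ChartedSpace H'' P] [IsManifold K ∞ P]

theorem tangentLift_comp (g : C^∞⟮J, N; K, P⟯) (f : C^∞⟮I, M; J, N⟯) :
    tangentLift (g.comp f) = (tangentLift g).comp (tangentLift f) :=
  ContMDiffMap.ext fun v => congrFun (tangentMap_comp (g.contMDiff.mdifferentiable (by simp))
    (f.contMDiff.mdifferentiable (by simp))) v

/-- The tangent map of a constant map is constant, with value a zero vector. -/
theorem tangentLift_const (y : N) :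
    tangentLift (ContMDiffMap.const y : C^∞⟮I, M; J, N⟯) =
      ContMDiffMap.const (Bundle.zeroSection E' (TangentSpace J : N → Type u) y) := by
  refine ContMDiffMap.ext fun v => ?_
  change tangentMap I J (fun _ => y) v = _
  simp only [tangentMap, mfderiv_const]
  rfl

/-- The identification `TN × TP ≅ T(N × P)`, as a smooth map. -/
noncomputable def tangentProdMap :
    C^∞⟮J.tangent.prod K.tangent, TangentBundle J N × TangentBundle K P;
      (J.prod K).tangent, TangentBundle (J.prod K) (N × P)⟯ :=
  ⟨(equivTangentBundleProd J N K P).symm, contMDiff_equivTangentBundleProd_symm⟩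

theorem tangentLift_prodMk (f : C^∞⟮I, M; J, N⟯) (g : C^∞⟮I, M; K, P⟯) :
    tangentLift (f.prodMk g) = tangentProdMap.comp ((tangentLift f).prodMk (tangentLift g)) := by
  refine ContMDiffMap.ext fun v => ?_
  change tangentMap I (J.prod K) (fun x => (f x, g x)) v = _
  simp only [tangentMap]
  rw [mfderiv_prodMk (f.contMDiff.mdifferentiable (by simp) _)
    (g.contMDiff.mdifferentiable (by simp) _)]
  rfl

/-- A finite-dimensional manifold is locally compact, so that continuity into the compact-open
topology is joint continuity. -/
theorem continuous_tangentTopology_zero_iff [FiniteDimensional ℝ E] {Z : Type*} [TopologicalSpace Z]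
    {φ : Z → C^∞⟮I, M; J, N⟯} :
    Continuous[_, tangentTopology 0 I M J N] φ ↔
      Continuous fun p : Z × M => φ p.1 p.2 := by
  have := Manifold.locallyCompact_of_finiteDimensional (M := M) I
  refine continuous_induced_rng.trans ⟨fun h => ?_, fun h => ?_⟩
  · exact ContinuousMap.continuous_uncurry_of_continuous ⟨_, h⟩
  · exact ContinuousMap.continuous_of_continuous_uncurry _ h

theorem continuous_tangentTopology_succ_iff {Z : Type*} [TopologicalSpace Z] {k : ℕ}
    {φ : Z → C^∞⟮I, M; J, N⟯} :
    Continuous[_, tangentTopology (k + 1) I M J N] φ ↔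
      Continuous[_, tangentTopology k I.tangent (TangentBundle I M) J.tangent (TangentBundle J N)]
        fun z => tangentLift (φ z) :=
  @continuous_induced_rng _ _ _ _ _
    (tangentTopology k I.tangent (TangentBundle I M) J.tangent (TangentBundle J N)) _

theorem continuous_weakTopology_iff {Z : Type*} [TopologicalSpace Z] {φ : Z → C^∞⟮I, M; J, N⟯} :
    Continuous[_, weakTopology I M J N] φ ↔
      ∀ k, Continuous[_, tangentTopology k I M J N] φ :=
  continuous_iInf_rng

end WeakTopology

theorem continuous_tangentTopology_const {Z : Type*} [TopologicalSpace Z] (k : ℕ) :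
    ∀ {E : Type u} [NormedAddCommGroup E] [NormedSpace ℝ E] [FiniteDimensional ℝ E]
      {H : Type u} [TopologicalSpace H] {I : ModelWithCorners ℝ E H}
      {M : Type u} [TopologicalSpace M] [ChartedSpace H M] [IsManifold I ∞ M]
      {E' : Type u} [NormedAddCommGroup E'] [NormedSpace ℝ E']
      {H' : Type u} [TopologicalSpace H'] {J : ModelWithCorners ℝ E' H'}
      {N : Type u} [TopologicalSpace N] [ChartedSpace H' N] [IsManifold J ∞ N]
      {y : Z → N}, Continuous y →
      Continuous[_, tangentTopology k I M J N] fun z => ContMDiffMap.const (y z) := by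
  induction k with
  | zero =>
    intro E _ _ _ H _ I M _ _ _ E' _ _ H' _ J N _ _ _ y hy
    exact continuous_tangentTopology_zero_iff.2 (hy.comp continuous_fst)
  | succ k ih =>
    intro E _ _ _ H _ I M _ _ _ E' _ _ H' _ J N _ _ _ y hy
    rw [continuous_tangentTopology_succ_iff]
    simp only [tangentLift_const]
    exact ih ((Bundle.contMDiff_zeroSection (n := ∞) (IB := J) ℝ
      (TangentSpace J : N → Type u)).continuous.comp hy)

/-- Composition is continuous: `T(g ∘ f) = Tg ∘ Tf` reduces this to the compact-open topology on
maps of the iterated tangent bundles, which are again finite-dimensional manifolds. -/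
theorem continuous_tangentTopology_comp {Z : Type*} [TopologicalSpace Z] (k : ℕ) :
    ∀ {E : Type u} [NormedAddCommGroup E] [NormedSpace ℝ E] [FiniteDimensional ℝ E]
      {H : Type u} [TopologicalSpace H] {I : ModelWithCorners ℝ E H}
      {M : Type u} [TopologicalSpace M] [ChartedSpace H M] [IsManifold I ∞ M]
      {E' : Type u} [NormedAddCommGroup E'] [NormedSpace ℝ E'] [FiniteDimensional ℝ E']
      {H' : Type u} [TopologicalSpace H'] {J : ModelWithCorners ℝ E' H'}
      {N : Type u} [TopologicalSpace N] [ChartedSpace H' N] [IsManifold J ∞ N]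
      {E'' : Type u} [NormedAddCommGroup E''] [NormedSpace ℝ E'']
      [FiniteDimensional ℝ E'']
      {H'' : Type u} [TopologicalSpace H''] {K : ModelWithCorners ℝ E'' H''}
      {P : Type u} [TopologicalSpace P] [ChartedSpace H'' P] [IsManifold K ∞ P]
      {g : Z → C^∞⟮J, N; K, P⟯} {f : Z → C^∞⟮I, M; J, N⟯},
      Continuous[_, tangentTopology k J N K P] g → Continuous[_, tangentTopology k I M J N] f →
      Continuous[_, tangentTopology k I M K P] fun z => (g z).comp (f z) := by
  induction k with
  | zero =>
    intro E _ _ _ H _ I M _ _ _ E' _ _ _ H' _ J N _ _ _ E'' _ _ _ H'' _ K P _ _ _ g f hg hf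
    rw [continuous_tangentTopology_zero_iff] at *
    exact hg.comp (continuous_fst.prodMk hf)
  | succ k ih =>
    intro E _ _ _ H _ I M _ _ _ E' _ _ _ H' _ J N _ _ _ E'' _ _ _ H'' _ K P _ _ _ g f hg hf
    rw [continuous_tangentTopology_succ_iff] at *
    simp only [tangentLift_comp]
    exact ih hg hf

theorem continuous_tangentTopology_prodMk {Z : Type*} [TopologicalSpace Z] (k : ℕ) :
    ∀ {E : Type u} [NormedAddCommGroup E] [NormedSpace ℝ E] [FiniteDimensional ℝ E]
      {H : Type u} [TopologicalSpace H] {I : ModelWithCorners ℝ E H}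
      {M : Type u} [TopologicalSpace M] [ChartedSpace H M] [IsManifold I ∞ M]
      {E' : Type u} [NormedAddCommGroup E'] [NormedSpace ℝ E'] [FiniteDimensional ℝ E']
      {H' : Type u} [TopologicalSpace H'] {J : ModelWithCorners ℝ E' H'}
      {N : Type u} [TopologicalSpace N] [ChartedSpace H' N] [IsManifold J ∞ N]
      {E'' : Type u} [NormedAddCommGroup E''] [NormedSpace ℝ E'']
      [FiniteDimensional ℝ E'']
      {H'' : Type u} [TopologicalSpace H''] {K : ModelWithCorners ℝ E'' H''}
      {P : Type u} [TopologicalSpace P] [ChartedSpace H'' P] [IsManifold K ∞ P]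
      {f : Z → C^∞⟮I, M; J, N⟯} {g : Z → C^∞⟮I, M; K, P⟯},
      Continuous[_, tangentTopology k I M J N] f → Continuous[_, tangentTopology k I M K P] g →
      Continuous[_, tangentTopology k I M (J.prod K) (N × P)] fun z => (f z).prodMk (g z) := by
  induction k with
  | zero =>
    intro E _ _ _ H _ I M _ _ _ E' _ _ _ H' _ J N _ _ _ E'' _ _ _ H'' _ K P _ _ _ f g hf hg
    rw [continuous_tangentTopology_zero_iff] at *
    exact hf.prodMk hg
  | succ k ih =>
    intro E _ _ _ H _ I M _ _ _ E' _ _ _ H' _ J N _ _ _ E'' _ _ _ H'' _ K P _ _ _ f g hf hg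
    rw [continuous_tangentTopology_succ_iff] at *
    simp only [tangentLift_prodMk]
    exact continuous_tangentTopology_comp k
      (@continuous_const _ _ _ (tangentTopology k _ _ _ _) tangentProdMap) (ih hf hg)

section WeakTopology

variable {E : Type u} [NormedAddCommGroup E] [NormedSpace ℝ E]
  {H : Type u} [TopologicalSpace H] {I : ModelWithCorners ℝ E H}
  {M : Type u} [TopologicalSpace M] [ChartedSpace H M] [IsManifold I ∞ M]
  {E' : Type u} [NormedAddCommGroup E'] [NormedSpace ℝ E']
  {H' : Type u} [TopologicalSpace H'] {J : ModelWithCorners ℝ E' H'}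
  {N : Type u} [TopologicalSpace N] [ChartedSpace H' N] [IsManifold J ∞ N]
  {E'' : Type u} [NormedAddCommGroup E''] [NormedSpace ℝ E'']
  {H'' : Type u} [TopologicalSpace H''] {K : ModelWithCorners ℝ E'' H''}
  {P : Type u} [TopologicalSpace P] [ChartedSpace H'' P] [IsManifold K ∞ P]
  {Z : Type*} [TopologicalSpace Z]

theorem continuous_weakTopology_const (g : C^∞⟮I, M; J, N⟯) :
    Continuous[_, weakTopology I M J N] fun _ : Z => g :=
  @continuous_const _ _ _ (weakTopology I M J N) g

theorem SelfEmb.continuous_iff {φ : Z → SelfEmb I M} :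
    Continuous φ ↔ Continuous[_, weakTopology I M I M]
      fun z => (⟨(φ z).1, (φ z).2.smooth⟩ : C^∞⟮I, M; I, M⟯) :=
  @continuous_induced_rng _ _ _ _ _ (weakTopology I M I M) _

variable [FiniteDimensional ℝ E] [FiniteDimensional ℝ E'] [FiniteDimensional ℝ E'']

theorem continuous_weakTopology_comp {g : Z → C^∞⟮J, N; K, P⟯} {f : Z → C^∞⟮I, M; J, N⟯}
    (hg : Continuous[_, weakTopology J N K P] g) (hf : Continuous[_, weakTopology I M J N] f) :
    Continuous[_, weakTopology I M K P] fun z => (g z).comp (f z) := by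
  rw [continuous_weakTopology_iff] at *
  exact fun k => continuous_tangentTopology_comp k (hg k) (hf k)

theorem continuous_weakTopology_prodMk {f : Z → C^∞⟮I, M; J, N⟯} {g : Z → C^∞⟮I, M; K, P⟯}
    (hf : Continuous[_, weakTopology I M J N] f) (hg : Continuous[_, weakTopology I M K P] g) :
    Continuous[_, weakTopology I M (J.prod K) (N × P)] fun z => (f z).prodMk (g z) := by
  rw [continuous_weakTopology_iff] at *
  exact fun k => continuous_tangentTopology_prodMk k (hf k) (hg k)

/-- The members of a family of maps that is jointly smooth in the variable and in a parameter
depend continuously on the parameter. -/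
theorem continuous_weakTopology_family (Φ : C^∞⟮K.prod I, P × M; J, N⟯) {p : Z → P}
    (hp : Continuous p) :
    Continuous[_, weakTopology I M J N] fun z =>
      Φ.comp ((ContMDiffMap.const (p z)).prodMk ContMDiffMap.id) :=
  continuous_weakTopology_comp (continuous_weakTopology_const Φ)
    (continuous_weakTopology_prodMk
      (continuous_weakTopology_iff.2 fun k => continuous_tangentTopology_const k hp)
      (continuous_weakTopology_const _))

instance : ContinuousMul (SelfEmb I M) where
  continuous_mul := by
    rw [SelfEmb.continuous_iff]
    exact continuous_weakTopology_comp (SelfEmb.continuous_iff.1 continuous_fst)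
      (SelfEmb.continuous_iff.1 continuous_snd)

end WeakTopology

/-! ### Continuity of conjugation by little cubes -/

section Conjugation

variable {E : Type u} [NormedAddCommGroup E] [NormedSpace ℝ E] [FiniteDimensional ℝ E]
  {H : Type u} [TopologicalSpace H] {I : ModelWithCorners ℝ E H}
  {M : Type u} [TopologicalSpace M] [ChartedSpace H M] [IsManifold I ∞ M]
  {Z : Type*} [TopologicalSpace Z]

variable (I M) in
/-- The map `(x, m) ↦ (c x + d, m)` of `ℝⁿ × M`, where `c` acts coordinatewise. -/
def affineMap {n : ℕ} (p : (Fin n → ℝ) × (Fin n → ℝ)) :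
    C^∞⟮model I n, (Fin n → ℝ) × M; model I n, (Fin n → ℝ) × M⟯ :=
  ⟨fun x => (p.1 * x.1 + p.2, x.2), contMDiff_affine (fun x => p.1 * x + p.2) (by fun_prop)⟩

theorem continuous_affineMap {n : ℕ} {p : Z → (Fin n → ℝ) × (Fin n → ℝ)} (hp : Continuous p) :
    Continuous[_, weakTopology (model I n) ((Fin n → ℝ) × M) (model I n) ((Fin n → ℝ) × M)]
      fun z => affineMap I M (p z) := by
  -- The factor `E` only serves to put the space of parameters into the universe of `M`.
  have hΦ : ContMDiff (𝓘(ℝ, ((Fin n → ℝ) × (Fin n → ℝ)) × E).prod (model I n)) (model I n) ∞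
      (fun q : (((Fin n → ℝ) × (Fin n → ℝ)) × E) × ((Fin n → ℝ) × M) =>
        (q.1.1.1 * q.2.1 + q.1.1.2, q.2.2)) := by
    have h1 : ContDiff ℝ ∞ (fun q : (((Fin n → ℝ) × (Fin n → ℝ)) × E) × (Fin n → ℝ) =>
        q.1.1.1 * q.2 + q.1.1.2) := by
      fun_prop
    exact (h1.contMDiff.comp (contMDiff_fst.prodMk_space contMDiff_snd.fst)).prodMk
      contMDiff_snd.snd
  exact continuous_weakTopology_family ⟨_, hΦ⟩ (p := fun z => (p z, 0)) (by fun_prop)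

theorem LittleCube.continuous_coeffs {n : ℕ} :
    Continuous fun L : LittleCube n => (L.a, L.b) := continuous_induced_dom

theorem LittleCube.continuous_a {n : ℕ} : Continuous (LittleCube.a : LittleCube n → _) :=
  continuous_fst.comp continuous_coeffs

theorem LittleCube.continuous_b {n : ℕ} : Continuous (LittleCube.b : LittleCube n → _) :=
  continuous_snd.comp continuous_coeffs

theorem LittleCube.continuous_drop {n : ℕ} (p : Fin (n + 1)) :
    Continuous (LittleCube.drop p : LittleCube (n + 1) → LittleCube n) := by
  refine continuous_induced_rng.2 (Continuous.prodMk ?_ ?_)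
  · exact continuous_pi fun i => (continuous_apply (p.succAbove i)).comp continuous_a
  · exact continuous_pi fun i => (continuous_apply (p.succAbove i)).comp continuous_b

theorem LittleCube.continuous_bottom {n : ℕ} (p : Fin n) :
    Continuous (LittleCube.bottom p : LittleCube n → ℝ) := by
  have ha := (continuous_apply p).comp (continuous_a (n := n))
  have hb := (continuous_apply p).comp (continuous_b (n := n))
  exact (ha.mul continuous_const).add hb

theorem continuous_conj {n : ℕ} {L : Z → LittleCube n}
    {f : Z → SelfEmb (model I n) ((Fin n → ℝ) × M)} (hL : Continuous L) (hf : Continuous f) :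
    Continuous fun z => conj (L z) (f z) := by
  rw [SelfEmb.continuous_iff] at *
  have ha := LittleCube.continuous_a.comp hL
  have hb := LittleCube.continuous_b.comp hL
  have ha' : Continuous fun z => (L z).a⁻¹ :=
    continuous_pi fun i => ((continuous_apply i).comp ha).inv₀ fun z => ((L z).a_pos i).ne'
  have h := continuous_weakTopology_comp (continuous_affineMap (I := I) (M := M) (ha.prodMk hb))
    (continuous_weakTopology_comp hf
      (continuous_affineMap (I := I) (M := M) (ha'.prodMk (ha'.mul hb).neg)))
  refine (congrArg (fun φ => Continuous[_, weakTopology _ _ _ _] φ)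
    (funext fun z => ContMDiffMap.ext fun x => ?_)).mp h
  have hx : (L z).a⁻¹ * x.1 + -((L z).a⁻¹ * (L z).b) = (L z).inv x.1 := by
    funext i
    simp only [Pi.add_apply, Pi.mul_apply, Pi.inv_apply, Pi.neg_apply, LittleCube.inv]
    ring
  change ((L z).a * ((f z).1 ((L z).a⁻¹ * x.1 + -((L z).a⁻¹ * (L z).b), x.2)).1 + (L z).b,
    ((f z).1 ((L z).a⁻¹ * x.1 + -((L z).a⁻¹ * (L z).b), x.2)).2) = _
  rw [hx]
  rfl

theorem EC.continuous_act {n : ℕ} :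
    Continuous fun q : LittleCube n × EC I M n => EC.act q.1 q.2 :=
  Continuous.subtype_mk (continuous_conj continuous_fst
    (continuous_subtype_val.comp continuous_snd)) _

theorem PEC.continuous_act {n : ℕ} :
    Continuous fun q : LittleCube (n + 1) × PEC I M n => PEC.act q.1 q.2 :=
  Continuous.subtype_mk (continuous_conj continuous_fst
    (continuous_subtype_val.comp continuous_snd)) _

end Conjugation

/-! ### Continuity of the maps between the embedding spaces -/

section Maps

variable {E : Type u} [NormedAddCommGroup E] [NormedSpace ℝ E]
  {H : Type u} [TopologicalSpace H] {I : ModelWithCorners ℝ E H}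
  {M : Type u} [TopologicalSpace M] [ChartedSpace H M] [IsManifold I ∞ M]

theorem isInducing_incl [T2Space M] {n : ℕ} :
    Topology.IsInducing (incl : EC I M (n + 1) → PEC I M n) :=
  Topology.IsInducing.of_comp (g := Subtype.val)
    (Continuous.subtype_mk continuous_subtype_val _) continuous_subtype_val
    Topology.IsInducing.subtypeVal

/-- The smooth map `(t, x) ↦ F(t)(x)` of a smooth loop `F`. -/
def Loops.uncurry {n : ℕ} (F : Loops I M n) :
    C^∞⟮𝓘(ℝ).prod (model I n), ℝ × ((Fin n → ℝ) × M); model I n, (Fin n → ℝ) × M⟯ :=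
  ⟨fun p => (F p.1).1 p.2, F.2.1⟩

theorem Loops.isInducing_uncurry {n : ℕ} :
    @Topology.IsInducing _ _ _ (weakTopology _ _ _ _) (Loops.uncurry : Loops I M n → _) :=
  @Topology.IsInducing.mk _ _ _ (weakTopology _ _ _ _) _ rfl

theorem Loops.continuous_uncurry {n : ℕ} :
    Continuous[_, weakTopology _ _ _ _] (Loops.uncurry : Loops I M n → _) :=
  @Topology.IsInducing.continuous _ _ _ (weakTopology _ _ _ _) _ Loops.isInducing_uncurry

/-- The map `(x, m) ↦ ((t, x), m)` from `ℝⁿ × M` to `ℝⁿ⁺¹ × M`. -/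
def sliceMap (t : ℝ) (n : ℕ) :
    C^∞⟮model I n, (Fin n → ℝ) × M; model I (n + 1), (Fin (n + 1) → ℝ) × M⟯ :=
  ⟨fun x => (Fin.cons t x.1, x.2), by
    have h : ContDiff ℝ ∞ (fun x : Fin n → ℝ => (Fin.cons t x : Fin (n + 1) → ℝ)) :=
      contDiff_cons.comp (contDiff_const.prodMk contDiff_id)
    exact (h.contMDiff.comp contMDiff_fst).prodMk contMDiff_snd⟩

variable [FiniteDimensional ℝ E]

theorem continuous_proj {n : ℕ} : Continuous (proj : PEC I M n → EC I M n) := by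
  refine Continuous.subtype_mk (SelfEmb.continuous_iff.2 ?_) _
  exact continuous_weakTopology_comp (continuous_weakTopology_const ⟨_, contMDiff_tail⟩)
    (continuous_weakTopology_comp (SelfEmb.continuous_iff.1 continuous_subtype_val)
      (continuous_weakTopology_const (sliceMap 1 n)))

/-- The map `((t, x), m) ↦ (t, (x, m))` from `ℝⁿ⁺¹ × M` to `ℝ × (ℝⁿ × M)`. -/
def splitMap (n : ℕ) : C^∞⟮model I (n + 1), (Fin (n + 1) → ℝ) × M;
    𝓘(ℝ).prod (model I n), ℝ × ((Fin n → ℝ) × M)⟯ :=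
  ⟨fun x => (x.1 0, (Fin.tail x.1, x.2)), by
    have hA : ContDiff ℝ ∞ (fun x : Fin (n + 1) → ℝ => x 0) := by fun_prop
    exact (hA.contMDiff.comp contMDiff_fst).prodMk contMDiff_tail⟩

/-- The map `(t, (x, m)) ↦ ((t, x), m)` from `ℝ × (ℝⁿ × M)` to `ℝⁿ⁺¹ × M`. -/
def joinMap (n : ℕ) : C^∞⟮𝓘(ℝ).prod (model I n), ℝ × ((Fin n → ℝ) × M);
    model I (n + 1), (Fin (n + 1) → ℝ) × M⟯ :=
  ⟨fun x => (Fin.cons x.1 x.2.1, x.2.2),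
    (contDiff_cons.contMDiff.comp (contMDiff_fst.prodMk_space contMDiff_snd.fst)).prodMk
      contMDiff_snd.snd⟩

theorem continuous_gr [CompactSpace M] [T2Space M] {n : ℕ} :
    Continuous (gr : Loops I M n → EC I M (n + 1)) := by
  refine Continuous.subtype_mk (SelfEmb.continuous_iff.2 ?_) _
  have hF := continuous_weakTopology_comp (Loops.continuous_uncurry (I := I) (M := M) (n := n))
    (continuous_weakTopology_const (splitMap n))
  have hΦ : ContMDiff ((model I (n + 1)).prod (model I n)) (model I (n + 1)) ∞
      (fun q : ((Fin (n + 1) → ℝ) × M) × ((Fin n → ℝ) × M) =>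
        ((Fin.cons (q.1.1 0) q.2.1 : Fin (n + 1) → ℝ), q.2.2)) :=
    (joinMap n).contMDiff.comp
      (((splitMap n).contMDiff.comp contMDiff_fst).fst.prodMk contMDiff_snd)
  exact continuous_weakTopology_comp (continuous_weakTopology_const ⟨_, hΦ⟩)
    (continuous_weakTopology_prodMk (continuous_weakTopology_const ContMDiffMap.id) hF)

/-- The weak topology on loops is the one induced from their graphs. -/
theorem isInducing_gr [CompactSpace M] [T2Space M] {n : ℕ} :
    Topology.IsInducing (gr : Loops I M n → EC I M (n + 1)) := by
  -- A loop is recovered from its graph by composition with fixed smooth maps on both sides.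
  let r (h : EC I M (n + 1)) :
      C^∞⟮𝓘(ℝ).prod (model I n), ℝ × ((Fin n → ℝ) × M); model I n, (Fin n → ℝ) × M⟯ :=
    ContMDiffMap.comp ⟨_, contMDiff_tail⟩ (ContMDiffMap.comp ⟨h.1.1, h.1.2.smooth⟩ (joinMap n))
  have hr : Continuous[_, weakTopology _ _ _ _] r :=
    continuous_weakTopology_comp (continuous_weakTopology_const _)
      (continuous_weakTopology_comp (SelfEmb.continuous_iff.1 continuous_subtype_val)
        (continuous_weakTopology_const _))
  refine @Topology.IsInducing.of_comp _ _ _ gr r _ _ (weakTopology _ _ _ _) continuous_gr hr ?_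
  refine (congrArg (fun φ => @Topology.IsInducing _ _ _ (weakTopology _ _ _ _) φ)
    (funext fun F => ContMDiffMap.ext fun q => ?_)).mp Loops.isInducing_uncurry
  change _ = (Fin.tail (graphFun F (Fin.cons q.1 q.2.1, q.2.2)).1,
    (graphFun F (Fin.cons q.1 q.2.1, q.2.2)).2)
  simp only [graphFun, Fin.tail_cons, Fin.cons_zero]
  rfl

end Maps

/-! ### Ordered products in a monoid -/

section OrderedProducts

/-- Two arrangements of the same factors have equal products if any two factors whose order is
reversed commute.  Here `R` and `S` are relations by which the two lists are ordered. -/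
theorem prod_map_eq_of_perm {ι X : Type*} [Monoid X] (f : ι → X) {R S : ι → ι → Prop} :
    ∀ {l₁ l₂ : List ι}, l₁.Perm l₂ → l₁.Pairwise R → l₂.Pairwise S →
      (∀ a b, R a b → S b a → Commute (f a) (f b)) → (l₁.map f).prod = (l₂.map f).prod
  | [], l₂, h, _, _, _ => by rw [h.nil_eq]
  | a :: t, l₂, h, hR, hS, hc => by
    obtain ⟨u, v, rfl⟩ := List.append_of_mem (h.mem_iff.1 List.mem_cons_self)
    have ht : t.Perm (u ++ v) := (h.trans List.perm_middle).cons_inv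
    have hS' : (u ++ v).Pairwise S := hS.sublist
      ((List.Sublist.refl u).append (List.sublist_cons_self a v))
    have hau : Commute (f a) (u.map f).prod := by
      refine Commute.list_prod_right _ _ fun y hy => ?_
      obtain ⟨b, hb, rfl⟩ := List.mem_map.1 hy
      refine hc a b ((List.pairwise_cons.1 hR).1 b (ht.mem_iff.2 (List.mem_append_left v hb))) ?_
      exact (List.pairwise_append.1 hS).2.2 b hb a List.mem_cons_self
    rw [List.map_cons, List.prod_cons,
      prod_map_eq_of_perm f ht (List.pairwise_cons.1 hR).2 hS' hc]
    simp only [List.map_append, List.prod_append, List.map_cons, List.prod_cons]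
    rw [← mul_assoc, hau.eq, mul_assoc]

variable {X : Type*} [Monoid X] {j : ℕ}

/-- The indices `0, …, j - 1` listed in increasing order of `t`. -/
noncomputable def sortedList (t : Fin j → ℝ) : List (Fin j) := List.ofFn (Tuple.sort t)

theorem orderedProd_eq (t : Fin j → ℝ) (x : Fin j → X) :
    orderedProd t x = ((sortedList t).map x).prod := by
  rw [orderedProd, sortedList, List.map_ofFn]
  rfl

theorem ofFn_perm_finRange (σ : Equiv.Perm (Fin j)) :
    (List.ofFn σ).Perm (List.finRange j) :=
  σ.ofFn_comp_perm id |>.trans (by rw [List.ofFn_id])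

theorem sortedList_perm (t : Fin j → ℝ) : (sortedList t).Perm (List.finRange j) :=
  ofFn_perm_finRange _

theorem pairwise_ofFn_of_monotone {t : Fin j → ℝ} {σ : Equiv.Perm (Fin j)}
    (h : Monotone (t ∘ σ)) : (List.ofFn σ).Pairwise fun a b => t a ≤ t b :=
  List.pairwise_ofFn.2 fun _ _ hab => h hab.le

theorem sortedList_pairwise (t : Fin j → ℝ) :
    (sortedList t).Pairwise fun a b => t a ≤ t b :=
  pairwise_ofFn_of_monotone (Tuple.monotone_sort t)

/-- If factors at equal heights commute, then any list of the indices in increasing order of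
height computes the ordered product. -/
theorem orderedProd_eq_of_perm {t : Fin j → ℝ} {x : Fin j → X}
    (hc : ∀ a b, a ≠ b → t a = t b → Commute (x a) (x b)) {l : List (Fin j)}
    (hl : l.Perm (List.finRange j)) (hs : l.Pairwise fun a b => t a ≤ t b) :
    orderedProd t x = (l.map x).prod := by
  rw [orderedProd_eq]
  refine prod_map_eq_of_perm x ((sortedList_perm t).trans hl.symm) (sortedList_pairwise t) hs
    fun a b hab hba => ?_
  rcases eq_or_ne a b with rfl | hne
  · exact Commute.refl _
  · exact hc a b hne (le_antisymm hab hba)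

theorem map_orderedProd {Y F : Type*} [Monoid Y] [FunLike F X Y] [MonoidHomClass F X Y] (φ : F)
    (t : Fin j → ℝ) (x : Fin j → X) :
    φ (orderedProd t x) = orderedProd t fun i => φ (x i) := by
  rw [orderedProd, orderedProd, map_list_prod, List.map_ofFn]
  rfl

end OrderedProducts

/-! ### Little cubes with overlapping factors -/

section Cubes

variable {n : ℕ}

theorem LittleCube.map_mem_Ioo (L : LittleCube n) (p : Fin n) {s : ℝ}
    (hs : s ∈ Set.Ioo (L.bottom p) (L.a p + L.b p)) :
    (s - L.b p) / L.a p ∈ Set.Ioo (-1 : ℝ) 1 := by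
  have := L.a_pos p
  simp only [Set.mem_Ioo, LittleCube.bottom] at *
  rw [lt_div_iff₀ this, div_lt_iff₀ this]
  constructor <;> linarith

/-- If two little cubes have disjoint interiors, but their `p`-th factors overlap, then they have
disjoint interiors after the `p`-th factors are removed. -/
theorem LittleCube.disjoint_drop {p : Fin (n + 1)} {L L' : LittleCube (n + 1)}
    (h : Disjoint (L.map '' openCube (n + 1)) (L'.map '' openCube (n + 1)))
    (h1 : L.bottom p < L'.a p + L'.b p) (h2 : L'.bottom p < L.a p + L.b p) :
    Disjoint ((L.drop p).map '' openCube n) ((L'.drop p).map '' openCube n) := by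
  have hb (K : LittleCube (n + 1)) : K.bottom p < K.a p + K.b p := by
    have := K.a_pos p
    simp only [LittleCube.bottom]
    linarith
  rw [Set.disjoint_left]
  rintro y ⟨u, hu, rfl⟩ ⟨v, hv, hvu⟩
  obtain ⟨s, hs1, hs2⟩ : ∃ s, max (L.bottom p) (L'.bottom p) < s ∧
      s < min (L.a p + L.b p) (L'.a p + L'.b p) :=
    exists_between (max_lt (lt_min (hb L) h1) (lt_min h2 (hb L')))
  rw [max_lt_iff] at hs1
  rw [lt_min_iff] at hs2
  have key (K : LittleCube (n + 1)) (hK : s ∈ Set.Ioo (K.bottom p) (K.a p + K.b p))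
      (w : Fin n → ℝ) (hw : w ∈ openCube n) :
      p.insertNth (α := fun _ => ℝ) s ((K.drop p).map w) ∈ K.map '' openCube (n + 1) := by
    refine ⟨p.insertNth (α := fun _ => ℝ) ((s - K.b p) / K.a p) w, fun i => ?_, ?_⟩
    · induction i using Fin.succAboveCases p with
      | x => simpa using K.map_mem_Ioo p hK
      | p i => simpa using hw i
    · funext i
      have := (K.a_pos p).ne'
      induction i using Fin.succAboveCases p with
      | x =>
        simp only [LittleCube.map, Fin.insertNth_apply_same]
        field_simp
        ring
      | p i => simp [LittleCube.map, LittleCube.drop]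
  refine Set.disjoint_left.1 h (key L ⟨hs1.1, hs2.1⟩ u hu) ?_
  rw [← hvu]
  exact key L' ⟨hs1.2, hs2.2⟩ v hv

theorem LittleCube.bottom_comp (L L' : LittleCube n) (p : Fin n) :
    (L.comp L').bottom p = L.a p * L'.bottom p + L.b p := by
  simp only [LittleCube.bottom, LittleCube.comp]
  ring

theorem LittleCube.bottom_mem (L : LittleCube n) (p : Fin n) :
    L.bottom p ∈ Set.Ico (-1 : ℝ) 1 := by
  have := L.a_pos p
  have := L.lower p
  have := L.upper p
  simp only [LittleCube.bottom, Set.mem_Ico]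
  constructor <;> linarith

theorem LittleCube.bottom_comp_mem (L L' : LittleCube n) (p : Fin n) :
    (L.comp L').bottom p ∈ Set.Ico (L.bottom p) (L.a p + L.b p) := by
  have := L'.bottom_mem p
  have := L.a_pos p
  rw [bottom_comp]
  simp only [Set.mem_Ico, LittleCube.bottom] at *
  constructor <;> nlinarith

end Cubes

/-! ### Ordered actions of little cubes -/

section Actions

open LittleCube

variable {n : ℕ} {X : Type*} [TopologicalSpace X] [Monoid X]

/-- A continuous action of the monoid of little `(n+1)`-cubes on a topological monoid, by monoid
endomorphisms, such that the images of two cubes that are disjoint after their `p`-th factors are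
removed commute. -/
structure IsOrderedAction (p : Fin (n + 1)) (act : LittleCube (n + 1) → X → X) : Prop where
  continuous : Continuous fun q : LittleCube (n + 1) × X => act q.1 q.2
  one_act : ∀ x, act .one x = x
  comp_act : ∀ L L' x, act (L.comp L') x = act L (act L' x)
  act_one : ∀ L, act L 1 = 1
  act_mul : ∀ L x y, act L (x * y) = act L x * act L y
  commute : ∀ L L', Disjoint ((L.drop p).map '' openCube n) ((L'.drop p).map '' openCube n) →
    ∀ x y, Commute (act L x) (act L' y)

namespace IsOrderedAction

variable {p : Fin (n + 1)} {act : LittleCube (n + 1) → X → X}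

theorem commute_of_bottom_eq (h : IsOrderedAction p act) {j : ℕ} (L : Cubes (n + 1) j)
    (x : Fin j → X) (a b : Fin j) (hne : a ≠ b) (hab : (L a).bottom p = (L b).bottom p) :
    Commute (act (L a) (x a)) (act (L b) (x b)) := by
  refine h.commute _ _ (disjoint_drop (L.2 a b hne) ?_ ?_) _ _
  · rw [hab]
    have := (L b).a_pos p
    simp only [LittleCube.bottom]
    linarith
  · rw [← hab]
    have := (L a).a_pos p
    simp only [LittleCube.bottom]
    linarith

theorem orderedProd_eq_ofFn (h : IsOrderedAction p act) {j : ℕ} (L : Cubes (n + 1) j)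
    (x : Fin j → X) {σ : Equiv.Perm (Fin j)}
    (hσ : Monotone ((fun i => (L i).bottom p) ∘ σ)) :
    orderedProd (fun i => (L i).bottom p) (fun i => act (L i) (x i)) =
      ((List.ofFn σ).map fun i => act (L i) (x i)).prod :=
  orderedProd_eq_of_perm (h.commute_of_bottom_eq L x) (ofFn_perm_finRange σ)
    (pairwise_ofFn_of_monotone hσ)

/-- The permutation that sorts the cubes may jump where two heights agree.  Near a given
configuration only permutations that sort that configuration occur, and there all of them give
the same product, so the ordered product is continuous. -/
theorem continuous_orderedProd [ContinuousMul X] (h : IsOrderedAction p act) (j : ℕ) :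
    Continuous fun q : Cubes (n + 1) j × (Fin j → X) =>
      orderedProd (fun i => (q.1 i).bottom p) (fun i => act (q.1 i) (q.2 i)) := by
  have hL (i : Fin j) : Continuous fun q : Cubes (n + 1) j × (Fin j → X) => q.1 i :=
    (continuous_apply i).comp (continuous_subtype_val.comp continuous_fst)
  have hprod (σ : Equiv.Perm (Fin j)) : Continuous fun q : Cubes (n + 1) j × (Fin j → X) =>
      ((List.ofFn σ).map fun i => act (q.1 i) (q.2 i)).prod :=
    continuous_list_prod _ fun i _ =>
      h.continuous.comp ((hL i).prodMk ((continuous_apply i).comp continuous_snd))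
  rw [continuous_iff_continuousAt]
  intro q₀ U hU
  have h1 : ∀ᶠ q in 𝓝 q₀, ∀ a b : Fin j, (q₀.1 a).bottom p < (q₀.1 b).bottom p →
      (q.1 a).bottom p < (q.1 b).bottom p := by
    rw [Filter.eventually_all]
    intro a
    rw [Filter.eventually_all]
    intro b
    by_cases hab : (q₀.1 a).bottom p < (q₀.1 b).bottom p
    · have := ((continuous_bottom p).comp (hL a)).continuousAt.eventually_lt
        ((continuous_bottom p).comp (hL b)).continuousAt hab
      exact this.mono fun q hq _ => hq
    · exact Filter.Eventually.of_forall fun q hq => (hab hq).elim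
  have h2 : ∀ᶠ q in 𝓝 q₀, ∀ σ : Equiv.Perm (Fin j),
      Monotone ((fun i => (q₀.1 i).bottom p) ∘ σ) →
        ((List.ofFn σ).map fun i => act (q.1 i) (q.2 i)).prod ∈ U := by
    rw [Filter.eventually_all]
    intro σ
    by_cases hσ : Monotone ((fun i => (q₀.1 i).bottom p) ∘ σ)
    · refine ((hprod σ).continuousAt.eventually_mem ?_).mono fun q hq _ => hq
      rwa [← h.orderedProd_eq_ofFn q₀.1 q₀.2 hσ]
    · exact Filter.Eventually.of_forall fun q hq => (hσ hq).elim
  rw [Filter.mem_map]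
  filter_upwards [h1, h2] with q hq1 hq2
  rw [Set.mem_preimage, orderedProd_eq]
  refine hq2 _ fun a b hab => ?_
  by_contra hlt
  exact (hq1 _ _ (not_le.1 hlt)).not_ge (Tuple.monotone_sort (fun i => (q.1 i).bottom p) hab)

/-- Both sides multiply the same factors, on the left in the order of the heights of the composed
cubes, on the right first by outer and then by inner cubes.  Two factors can change places only if
they belong to the same outer cube and to inner cubes at equal heights, or to different outer
cubes whose `p`-th factors overlap, and in both cases they commute. -/
theorem associativity (h : IsOrderedAction p act) (m : ℕ) (j : Fin m → ℕ)
    (L : Cubes (n + 1) m) (L' : ∀ i, Cubes (n + 1) (j i)) (x : ∀ i, Fin (j i) → X) :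
    orderedProd (fun q => ((L.comp L') q).bottom p)
        (fun q => act ((L.comp L') q)
          (x (finSigmaFinEquiv.symm q).1 (finSigmaFinEquiv.symm q).2)) =
      orderedProd (fun i => (L i).bottom p) (fun i => act (L i)
        (orderedProd (fun k => (L' i k).bottom p) (fun k => act (L' i k) (x i k)))) := by
  let c (q : (i : Fin m) × Fin (j i)) : LittleCube (n + 1) := (L q.1).comp (L' q.1 q.2)
  let f (q : (i : Fin m) × Fin (j i)) : X := act (L q.1) (act (L' q.1 q.2) (x q.1 q.2))
  let l₁ : List ((i : Fin m) × Fin (j i)) :=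
    (sortedList fun q => ((L.comp L') q).bottom p).map finSigmaFinEquiv.symm
  let s (i : Fin m) : List (Fin (j i)) := sortedList fun k => (L' i k).bottom p
  let l₂ : List ((i : Fin m) × Fin (j i)) :=
    (sortedList fun i => (L i).bottom p).flatMap fun i => (s i).map (Sigma.mk i)
  let R (q q' : (i : Fin m) × Fin (j i)) : Prop := (c q).bottom p ≤ (c q').bottom p
  let S (q q' : (i : Fin m) × Fin (j i)) : Prop :=
    q.1 = q'.1 ∧ (c q).bottom p ≤ (c q').bottom p ∨
      q.1 ≠ q'.1 ∧ (L q.1).bottom p ≤ (L q'.1).bottom p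
  have hnodup {k : ℕ} (t : Fin k → ℝ) : (sortedList t).Nodup :=
    (sortedList_perm t).nodup_iff.2 (List.nodup_finRange k)
  have hmem {k : ℕ} (t : Fin k → ℝ) (a : Fin k) : a ∈ sortedList t :=
    (sortedList_perm t).mem_iff.2 (List.mem_finRange a)
  let hom (K : LittleCube (n + 1)) : X →* X := ⟨⟨act K, h.act_one K⟩, h.act_mul K⟩
  have e₁ : orderedProd (fun q => ((L.comp L') q).bottom p)
      (fun q => act ((L.comp L') q)
        (x (finSigmaFinEquiv.symm q).1 (finSigmaFinEquiv.symm q).2)) = (l₁.map f).prod := by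
    rw [orderedProd_eq, List.map_map]
    congr 2
    funext q
    exact h.comp_act _ _ _
  have e₂ : orderedProd (fun i => (L i).bottom p) (fun i => act (L i)
      (orderedProd (fun k => (L' i k).bottom p) (fun k => act (L' i k) (x i k)))) =
        (l₂.map f).prod := by
    rw [orderedProd_eq, List.map_flatMap, List.flatMap, List.prod_flatten, List.map_map]
    congr 2
    funext i
    refine (map_orderedProd (hom (L i)) _ _).trans ?_
    rw [orderedProd_eq, Function.comp_apply, List.map_map]
    rfl
  rw [e₁, e₂]
  refine prod_map_eq_of_perm (R := R) (S := S) f ?_ ?_ ?_ ?_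
  · refine (List.perm_ext_iff_of_nodup ((hnodup _).map finSigmaFinEquiv.symm.injective) ?_).2
      fun q => ?_
    · refine List.nodup_flatMap.2 ⟨fun i _ => (hnodup _).map sigma_mk_injective, ?_⟩
      refine (hnodup _).imp fun hne => ?_
      rw [Function.onFun, List.disjoint_left]
      rintro q hq hq'
      obtain ⟨k, _, rfl⟩ := List.mem_map.1 hq
      obtain ⟨k', _, hk⟩ := List.mem_map.1 hq'
      exact hne (congrArg Sigma.fst hk).symm
    · refine iff_of_true ?_ ?_
      · exact List.mem_map.2 ⟨finSigmaFinEquiv q, hmem _ _, Equiv.symm_apply_apply _ _⟩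
      · exact List.mem_flatMap.2 ⟨q.1, hmem _ _, List.mem_map.2 ⟨q.2, hmem _ _, rfl⟩⟩
  · exact List.pairwise_map.2 (sortedList_pairwise _)
  · refine List.pairwise_flatMap.2 ⟨fun i _ => ?_, ?_⟩
    · refine List.pairwise_map.2 ((sortedList_pairwise _).imp fun {a b} hab => Or.inl ⟨rfl, ?_⟩)
      simp only [c, LittleCube.bottom_comp]
      have := (L i).a_pos p
      gcongr
    · refine ((hnodup _).and (sortedList_pairwise _)).imp ?_
      rintro i i' ⟨hne, hle⟩ q hq q' hq'
      obtain ⟨k, _, rfl⟩ := List.mem_map.1 hq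
      obtain ⟨k', _, rfl⟩ := List.mem_map.1 hq'
      exact Or.inr ⟨hne, hle⟩
  · rintro ⟨i, k⟩ ⟨i', k'⟩ hR (⟨hi, hS⟩ | ⟨hi, hS⟩)
    · obtain rfl : i' = i := hi
      rcases eq_or_ne k k' with rfl | hne
      · exact Commute.refl _
      have heq := le_antisymm hR hS
      simp only [c, LittleCube.bottom_comp, add_left_inj] at heq
      have heq' := mul_left_cancel₀ ((L i').a_pos p).ne' heq
      exact (h.commute_of_bottom_eq (L' i') (x i') k k' hne heq').map (hom (L i'))
    · -- The bottoms are interleaved, so the `p`-th factors of the outer cubes overlap.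
      have h1 := (L i).bottom_comp_mem (L' i k) p
      have h2 := (L i').bottom_comp_mem (L' i' k') p
      refine h.commute _ _ (disjoint_drop (L.2 i i' (Ne.symm hi)) ?_ ?_) _ _
      · exact (h1.1.trans hR).trans_lt h2.2
      · refine lt_of_le_of_lt hS ?_
        have := (L i).a_pos p
        simp only [LittleCube.bottom]
        linarith

theorem isCubesObject [ContinuousMul X] (h : IsOrderedAction p act) :
    IsCubesObject (n + 1) fun j (L : Cubes (n + 1) j) (x : Fin j → X) =>
      orderedProd (fun i => (L i).bottom p) (fun i => act (L i) (x i)) where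
  continuous := h.continuous_orderedProd
  identity x := by
    simp only [orderedProd, List.ofFn_succ, List.ofFn_zero, List.prod_cons, List.prod_nil, mul_one]
    exact h.one_act x
  symmetry j L σ x := by
    have hmono : Monotone ((fun i => (L i).bottom p) ∘
        ((Tuple.sort fun i => ((L.perm σ) i).bottom p).trans σ)) :=
      Tuple.monotone_sort fun i => ((L.perm σ) i).bottom p
    rw [h.orderedProd_eq_ofFn L x hmono, orderedProd, List.map_ofFn]
    rfl
  associativity := h.associativity

end IsOrderedAction

/-- An injective map that induces the topology pulls back the structure of a little cubes
object. -/
theorem IsCubesObject.of_injective {X Y : Type*} [TopologicalSpace X] [TopologicalSpace Y] {n : ℕ}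
    {κ : (j : ℕ) → Cubes n j → (Fin j → X) → X} {κ' : (j : ℕ) → Cubes n j → (Fin j → Y) → Y}
    {φ : X → Y} (h : IsCubesObject n κ') (hφ : Topology.IsInducing φ)
    (hinj : Function.Injective φ)
    (heq : ∀ (j : ℕ) (L : Cubes n j) (x : Fin j → X), φ (κ j L x) = κ' j L (fun i => φ (x i))) :
    IsCubesObject n κ where
  continuous j := by
    rw [hφ.continuous_iff]
    have : Continuous fun q : Cubes n j × (Fin j → X) => κ' j q.1 fun i => φ (q.2 i) :=
      (h.continuous j).comp (continuous_fst.prodMk (continuous_pi fun i =>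
        hφ.continuous.comp ((continuous_apply i).comp continuous_snd)))
    exact this.congr fun q => (heq j q.1 q.2).symm
  identity x := hinj (by rw [heq, h.identity])
  symmetry j L σ x := hinj (by rw [heq, heq]; exact h.symmetry j L σ fun i => φ (x i))
  associativity m j L L' x := hinj (by
    rw [heq, heq]
    simp only [heq]
    exact h.associativity m j L L' fun i k => φ (x i k))

end Actions

/-! ### Disjoint supports -/

section Supports

variable {E : Type u} [NormedAddCommGroup E] [NormedSpace ℝ E]
  {H : Type u} [TopologicalSpace H] {I : ModelWithCorners ℝ E H}
  {M : Type u} [TopologicalSpace M] [ChartedSpace H M] {n : ℕ}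

open LittleCube

/-- Self-embeddings that move disjoint sets of points commute, because an injective map sends
the points that it moves to points that it moves. -/
theorem SelfEmb.commute_of_disjoint {f g : SelfEmb I M} (h : ∀ x, f x ≠ x → g x = x) :
    Commute f g := by
  refine SelfEmb.ext fun x => ?_
  rw [SelfEmb.mul_apply, SelfEmb.mul_apply]
  by_cases hf : f x = x
  · rw [hf]
    by_contra hne
    have hg : g x = x := g.2.embedding.injective (h _ hne)
    exact hne (by rw [hg, hf])
  · rw [h x hf]
    exact (h _ fun hff => hf (f.2.embedding.injective hff)).symm

theorem SelfEmb.isOpen_ne [T2Space M] (f : SelfEmb I M) : IsOpen {x | f x ≠ x} :=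
  isOpen_ne_fun f.2.smooth.continuous continuous_id

/-- If the moved points of a self-embedding of `ℝⁿ × M` have their `i`-th coordinate in `s`, then
they have it in the interior of `s`, because they form an open set. -/
theorem mem_interior_of_ne [T2Space M] (f : SelfEmb (model I n) ((Fin n → ℝ) × M)) (i : Fin n)
    {s : Set ℝ} (hs : ∀ x, f x ≠ x → x.1 i ∈ s) (x : (Fin n → ℝ) × M) (hx : f x ≠ x) :
    x.1 i ∈ interior s := by
  have hc : Continuous fun x : (Fin n → ℝ) × M => x.1 i :=
    (continuous_apply i).comp continuous_fst
  have ho : IsOpenMap fun x : (Fin n → ℝ) × M => x.1 i :=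
    (isOpenMap_eval i).comp isOpenMap_fst
  have h := interior_maximal (s := (fun x : (Fin n → ℝ) × M => x.1 i) ⁻¹' s) (t := {x | f x ≠ x})
    (fun x hx => hs x hx) f.isOpen_ne hx
  rwa [← ho.preimage_interior_eq_interior_preimage hc] at h

theorem EC.mem_openCube [T2Space M] (f : EC I M n) (x) (hx : f.1 x ≠ x) : x.1 ∈ openCube n :=
  fun i => interior_Icc (a := (-1 : ℝ)) (b := 1) ▸
    mem_interior_of_ne f.1 i (fun x hx => f.2 x hx i) x hx

theorem PEC.tail_mem_openCube [T2Space M] (f : PEC I M n) (x) (hx : f.1 x ≠ x) :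
    Fin.tail x.1 ∈ openCube n :=
  fun i => interior_Icc (a := (-1 : ℝ)) (b := 1) ▸
    mem_interior_of_ne f.1 i.succ (fun x hx => (f.2.1 x hx).2 i) x hx

/-- Cubes with disjoint interiors may share boundary points; this is harmless, as the points moved
by an element of `EC(n, M)` lie over the open cube. -/
theorem EC.commute_act [T2Space M] {L L' : LittleCube n}
    (h : Disjoint (L.map '' openCube n) (L'.map '' openCube n)) (f g : EC I M n) :
    Commute (EC.act L f) (EC.act L' g) := by
  refine Subtype.ext (SelfEmb.commute_of_disjoint fun x hx => ?_)
  by_contra hx'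
  exact Set.disjoint_left.1 h ⟨_, EC.mem_openCube f _ (conj_ne hx), L.map_inv _⟩
    ⟨_, EC.mem_openCube g _ (conj_ne hx'), L'.map_inv _⟩

/-- The points moved by an element of `PEC(n+1, M)` may be unbounded in the first coordinate, so
here the cubes have to be disjoint in the other coordinates. -/
theorem PEC.commute_act [T2Space M] {L L' : LittleCube (n + 1)}
    (h : Disjoint ((L.drop 0).map '' openCube n) ((L'.drop 0).map '' openCube n))
    (f g : PEC I M n) : Commute (PEC.act L f) (PEC.act L' g) := by
  have key (K : LittleCube (n + 1)) (k : PEC I M n) (x : (Fin (n + 1) → ℝ) × M)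
      (hx : conj K k.1 x ≠ x) : Fin.tail x.1 ∈ (K.drop 0).map '' openCube n := by
    refine ⟨_, PEC.tail_mem_openCube k _ (conj_ne hx), funext fun i => ?_⟩
    exact congrFun (K.map_inv x.1) i.succ
  refine Subtype.ext (SelfEmb.commute_of_disjoint fun x hx => ?_)
  by_contra hx'
  exact Set.disjoint_left.1 h (key L f x hx) (key L' g x hx')

end Supports

/-! ### The actions of little cubes by conjugation -/

section Actions

variable {E : Type u} [NormedAddCommGroup E] [NormedSpace ℝ E]
  {H : Type u} [TopologicalSpace H] {I : ModelWithCorners ℝ E H}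
  {M : Type u} [TopologicalSpace M] [ChartedSpace H M] {n : ℕ}

theorem LittleCube.comp_inv (L L' : LittleCube n) (x) :
    (L.comp L').inv x = L'.inv (L.inv x) := by
  rw [← L'.inv_map ((L.comp L').inv x), ← L.inv_map (L'.map _), ← comp_map, map_inv]

theorem conj_one_cube (f : SelfEmb (model I n) ((Fin n → ℝ) × M)) :
    conj LittleCube.one f = f := by
  refine SelfEmb.ext fun x => ?_
  have h1 (y : Fin n → ℝ) : LittleCube.one.map y = y :=
    funext fun i => by simp [LittleCube.map, LittleCube.one]
  have h2 (y : Fin n → ℝ) : LittleCube.one.inv y = y :=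
    funext fun i => by simp [LittleCube.inv, LittleCube.one]
  rw [conj_apply, h1, h2]

theorem conj_comp (L L' : LittleCube n) (f : SelfEmb (model I n) ((Fin n → ℝ) × M)) :
    conj (L.comp L') f = conj L (conj L' f) :=
  SelfEmb.ext fun x => by
    simp only [conj_apply, LittleCube.comp_map, LittleCube.comp_inv]

theorem conj_one (L : LittleCube n) :
    conj L (1 : SelfEmb (model I n) ((Fin n → ℝ) × M)) = 1 :=
  SelfEmb.ext fun x => by simp [conj_apply, LittleCube.map_inv]

theorem conj_mul (L : LittleCube n) (f g : SelfEmb (model I n) ((Fin n → ℝ) × M)) :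
    conj L (f * g) = conj L f * conj L g :=
  SelfEmb.ext fun x => by simp [conj_apply, LittleCube.inv_map]

variable [FiniteDimensional ℝ E] [IsManifold I ∞ M] [T2Space M]

theorem EC.isOrderedAction (p : Fin (n + 1)) :
    IsOrderedAction p fun L (f : EC I M n) => EC.act (L.drop p) f where
  continuous := EC.continuous_act.comp
    (((LittleCube.continuous_drop p).comp continuous_fst).prodMk continuous_snd)
  one_act f := Subtype.ext (conj_one_cube f.1)
  comp_act L L' f := Subtype.ext (conj_comp (L.drop p) (L'.drop p) f.1)
  act_one L := Subtype.ext (conj_one (L.drop p))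
  act_mul L f g := Subtype.ext (conj_mul (L.drop p) f.1 g.1)
  commute _ _ h f g := EC.commute_act h f g

theorem PEC.isOrderedAction :
    IsOrderedAction 0 (PEC.act : LittleCube (n + 1) → PEC I M n → PEC I M n) where
  continuous := PEC.continuous_act
  one_act f := Subtype.ext (conj_one_cube f.1)
  comp_act L L' f := Subtype.ext (conj_comp L L' f.1)
  act_one L := Subtype.ext (conj_one L)
  act_mul L f g := Subtype.ext (conj_mul L f.1 g.1)
  commute _ _ h f g := PEC.commute_act h f g

theorem EC.isCubesObject_kappa (p : Fin (n + 1)) :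
    IsCubesObject (n + 1) (EC.kappa (I := I) (M := M) p) :=
  (EC.isOrderedAction p).isCubesObject

theorem PEC.isCubesObject_kappa :
    IsCubesObject (n + 1) (PEC.kappa (I := I) (M := M) (n := n)) :=
  PEC.isOrderedAction.isCubesObject

end Actions

/-! ### The fibre inclusion, the projection and the graphing map -/

section Maps

variable {E : Type u} [NormedAddCommGroup E] [NormedSpace ℝ E]
  {H : Type u} [TopologicalSpace H] {I : ModelWithCorners ℝ E H}
  {M : Type u} [TopologicalSpace M] [ChartedSpace H M] {n : ℕ}

/-- The fibre inclusion as a homomorphism of monoids. -/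
noncomputable def inclHom [T2Space M] : EC I M (n + 1) →* PEC I M n where
  toFun := incl
  map_one' := rfl
  map_mul' _ _ := rfl

theorem incl_injective [T2Space M] :
    Function.Injective (incl : EC I M (n + 1) → PEC I M n) :=
  fun _ _ h => Subtype.ext (congrArg (fun f : PEC I M n => f.1) h)

/-- The order of the factors in the target is irrelevant, as factors from cubes with disjoint
interiors commute in `EC(n+1, M)`. -/
theorem incl_concat [T2Space M] (j : ℕ) (L : Cubes (n + 1) j) (f : Fin j → EC I M (n + 1)) :
    incl (EC.concat (n + 1) j L f) = PEC.kappa j L fun i => incl (f i) := by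
  have h : EC.concat (n + 1) j L f =
      orderedProd (fun i => (L i).bottom 0) (fun i => EC.act (L i) (f i)) := by
    rw [orderedProd_eq, EC.concat, List.ofFn_eq_map]
    refine prod_map_eq_of_perm (R := fun _ _ => True) (S := fun _ _ => True) _
      (sortedList_perm _).symm (List.pairwise_of_forall fun _ _ => trivial)
      (List.pairwise_of_forall fun _ _ => trivial) fun a b _ _ => ?_
    rcases eq_or_ne a b with rfl | hne
    · exact Commute.refl _
    · exact EC.commute_act (L.2 a b hne) _ _
  rw [h]
  exact map_orderedProd inclHom _ _

/-- Over `[1, ∞)` an element of `PEC` is the product of the identity and its projection. -/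
theorem PEC.apply_cons (f : PEC I M n) {t : ℝ} (ht : 1 ≤ t) (y : (Fin n → ℝ) × M) :
    f.1 (Fin.cons t y.1, y.2) = (Fin.cons t ((proj f).1 y).1, ((proj f).1 y).2) := by
  obtain ⟨g, -, hg⟩ := f.2.2
  have : (proj f).1 y = g y := by
    change (Fin.tail (f.1 (Fin.cons 1 y.1, y.2)).1, (f.1 (Fin.cons 1 y.1, y.2)).2) = g y
    rw [hg 1 y le_rfl, Fin.tail_cons]
  rw [this, hg t y ht]

theorem proj_apply (f : PEC I M n) (y : (Fin n → ℝ) × M) :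
    (proj f).1 y = (Fin.tail (f.1 (Fin.cons 1 y.1, y.2)).1, (f.1 (Fin.cons 1 y.1, y.2)).2) := rfl

/-- The projection as a homomorphism of monoids. -/
noncomputable def projHom : PEC I M n →* EC I M n where
  toFun := proj
  map_one' := Subtype.ext (SelfEmb.ext fun _ => rfl)
  map_mul' f g := Subtype.ext (SelfEmb.ext fun y => by
    rw [proj_apply, Submonoid.coe_mul, SelfEmb.mul_apply, PEC.apply_cons g le_rfl,
      PEC.apply_cons f le_rfl, Fin.tail_cons]
    rfl)

/-- Conjugation by a little cube moves the slice over `1` to a slice over a number that is at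
least `1`, where the embedding is still given by its projection. -/
theorem proj_act (L : LittleCube (n + 1)) (f : PEC I M n) :
    proj (PEC.act L f) = EC.act (L.drop 0) (proj f) := by
  refine Subtype.ext (SelfEmb.ext fun y => ?_)
  have ht : 1 ≤ (1 - L.b 0) / L.a 0 := by
    rw [le_div_iff₀ (L.a_pos 0)]
    linarith [L.upper 0]
  rw [proj_apply]
  simp only [PEC.act, EC.act, conj_apply, inv_cons]
  rw [PEC.apply_cons f ht ((L.drop 0).inv y.1, y.2), map_cons, Fin.tail_cons]

theorem proj_kappa (j : ℕ) (L : Cubes (n + 1) j) (f : Fin j → PEC I M n) :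
    proj (PEC.kappa j L f) = EC.kappa 0 j L fun i => proj (f i) := by
  refine (map_orderedProd projHom _ _).trans ?_
  simp only [EC.kappa, ← proj_act]
  rfl

variable [CompactSpace M] [T2Space M]

theorem gr_apply (F : Loops I M n) (x : (Fin (n + 1) → ℝ) × M) :
    (gr F).1 x = graphFun F x := rfl

/-- The graphing map as a homomorphism of monoids. -/
noncomputable def grHom : Loops I M n →* EC I M (n + 1) where
  toFun := gr
  map_one' := Subtype.ext (SelfEmb.ext fun x => by
    change (Fin.cons (x.1 0) (Fin.tail x.1), x.2) = x
    rw [Fin.cons_self_tail])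
  map_mul' F G := Subtype.ext (SelfEmb.ext fun x => by
    rw [Submonoid.coe_mul, SelfEmb.mul_apply]
    simp only [gr_apply, graphFun, Fin.cons_zero, Fin.tail_cons]
    rfl)

theorem gr_injective : Function.Injective (gr : Loops I M n → EC I M (n + 1)) := by
  intro F G h
  refine Subtype.ext (funext fun t => Subtype.ext (SelfEmb.ext fun y => ?_))
  have hx : graphFun F (Fin.cons t y.1, y.2) = graphFun G (Fin.cons t y.1, y.2) :=
    congrArg (fun f : EC I M (n + 1) => f.1 (Fin.cons t y.1, y.2)) h
  simp only [graphFun, Fin.cons_zero, Fin.tail_cons, Prod.mk.injEq, Fin.cons_inj] at hx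
  exact Prod.ext hx.1.2 hx.2

theorem gr_act (L : LittleCube (n + 2)) (F : Loops I M n) :
    gr (Loops.act L F) = EC.act (L.drop (Fin.last (n + 1))) (gr F) := by
  -- Removing the last factor and then the first is removing the first and then the last.
  have hdrop : (L.drop (Fin.last (n + 1))).drop 0 = (L.drop 0).drop (Fin.last n) := by
    ext i <;> simp [LittleCube.drop]
  have ha : (L.drop (Fin.last (n + 1))).a 0 = L.a 0 := by simp [LittleCube.drop]
  have hb : (L.drop (Fin.last (n + 1))).b 0 = L.b 0 := by simp [LittleCube.drop]
  refine Subtype.ext (SelfEmb.ext fun x => ?_)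
  obtain ⟨t, y, m, rfl⟩ : ∃ (t : ℝ) (y : Fin n → ℝ) (m : M), x = (Fin.cons t y, m) :=
    ⟨x.1 0, Fin.tail x.1, x.2, by rw [Fin.cons_self_tail]⟩
  have ha0 := (L.a_pos 0).ne'
  change graphFun (Loops.act L F) _ = conj _ (gr F).1 _
  rw [conj_apply, inv_cons, gr_apply]
  simp only [graphFun, map_cons, Fin.cons_zero, Fin.tail_cons, hdrop, ha, hb]
  rw [show L.a 0 * ((t - L.b 0) / L.a 0) + L.b 0 = t by field_simp; ring]
  rfl

theorem gr_kappa (j : ℕ) (L : Cubes (n + 2) j) (F : Fin j → Loops I M n) :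
    gr (Loops.kappa j L F) = EC.kappa (Fin.last (n + 1)) j L fun i => gr (F i) := by
  refine (map_orderedProd grHom _ _).trans ?_
  simp only [EC.kappa, ← gr_act]
  rfl

end Maps

end CubeEmb

theorem proposition4p3
    {E : Type u} [NormedAddCommGroup E] [NormedSpace ℝ E] [FiniteDimensional ℝ E]
    {H : Type u} [TopologicalSpace H] (I : ModelWithCorners ℝ E H)
    (M : Type u) [TopologicalSpace M] [ChartedSpace H M] [IsManifold I ∞ M]
    [CompactSpace M] [T2Space M] (n : ℕ) :
    CubeEmb.IsCubesMap (n + 1) (CubeEmb.EC.concat (I := I) (M := M) (n + 1)) CubeEmb.PEC.kappa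
        CubeEmb.incl ∧
      CubeEmb.IsCubesMap (n + 1) CubeEmb.PEC.kappa (CubeEmb.EC.kappa (I := I) (M := M) (n := n) 0)
        CubeEmb.proj ∧
      CubeEmb.IsCubesMap (n + 2) CubeEmb.Loops.kappa
        (CubeEmb.EC.kappa (I := I) (M := M) (n := n + 1) (Fin.last (n + 1))) CubeEmb.gr := by
  refine ⟨⟨?_, ?_, ?_, ?_⟩, ⟨?_, ?_, ?_, ?_⟩, ⟨?_, ?_, ?_, ?_⟩⟩
  · exact CubeEmb.PEC.isCubesObject_kappa.of_injective CubeEmb.isInducing_incl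
      CubeEmb.incl_injective CubeEmb.incl_concat
  · exact CubeEmb.PEC.isCubesObject_kappa
  · exact CubeEmb.isInducing_incl.continuous
  · exact CubeEmb.incl_concat
  · exact CubeEmb.PEC.isCubesObject_kappa
  · exact CubeEmb.EC.isCubesObject_kappa 0
  · exact CubeEmb.continuous_proj
  · exact CubeEmb.proj_kappa
  · exact (CubeEmb.EC.isCubesObject_kappa (Fin.last (n + 1))).of_injective
      CubeEmb.isInducing_gr CubeEmb.gr_injective CubeEmb.gr_kappa
  · exact CubeEmb.EC.isCubesObject_kappa (Fin.last (n + 1))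
  · exact CubeEmb.continuous_gr
  · exact CubeEmb.gr_kappa
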